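/- A \emph{metrized graph} $\Gamma$ is a finite connected graph (non-empty vertex set $V$, edge set $E$; multiple edges and self-loops allowed) in which each edge $e$ is identified with a segment of length $L_e>0$; it is regarded as a topological space, and $\ell(\Gamma)=\sum_{e\in E}L_e$. The valence $\upsilon(p)$ is the number of directions emanating from $p$. It is \emph{irreducible} if it cannot be disconnected by deleting any single point (vertex or not). For $y,z\in\Gamma$ let $j_z(\cdot,y)$ be the voltage function, i.e. the continuous piecewise affine function on $\Gamma$ with $\Delta_x j_z(x,y)=\delta_y-\delta_z$ and $j_z(z,y)=0$, where $\Delta f=-f''\,dx-\sum_p\big(\sum_{\vec v\text{ at }p}d_{\vec v}f(p)\big)\delta_p$; let $r(x,y)=j_y(x,x)$ be the resistance function, and let $R_e$ be the resistance between the end points of $e$ in the graph obtained from $\Gamma$ by deleting the interior of $e$ ($R_e=\infty$ if this graph is disconnected). A \emph{polarized metrized graph} (pm-graph) is a metrized graph $\Gamma$ with a function $\mathbf q:V\to\mathbb Z_{\ge0}$ such that $\upsilon(p)-2+2\mathbf q(p)\ge0$ for all $p\in V$; it is irreducible if its underlying metrized graph is. Its genus is $\bar g=|E|-|V|+1+\sum_{p\in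 V}\mathbf q(p)$. Put $$\delta_K=\sum_{p\in V}(\upsilon(p)-2+2\mathbf q(p))\,\delta_p,\qquad \mu_{ad}=\frac1{\bar g}\Big(\sum_{p\in V}\mathbf q(p)\,\delta_p+\sum_{e\in E}\frac{dx|_e}{L_e+R_e}\Big),$$ $$\epsilon(\Gamma)=\iint_{\Gamma\times\Gamma} r(x,y)\,\delta_K(x)\,\mu_{ad}(y),\qquad a(\Gamma)=\frac12\iint_{\Gamma\times\Gamma} r(x,y)\,\mu_{ad}(x)\,\mu_{ad}(y),$$ $$\varphi(\Gamma)=3\bar g\,a(\Gamma)-\frac14\big(\epsilon(\Gamma)+\ell(\Gamma)\big).$$ \textbf{Theorem.} Let $\Gamma$ be an irreducible pm-graph of genus $\bar g=3$. Then $$\varphi(\Gamma)\ \ge\ \frac{892-11\sqrt{79}}{14580}\,\ell(\Gamma)$$ (the constant is approximately $0.0545$). -/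

import Mathlib

open Set Filter Topology MeasureTheory

/-- A graph with edges of positive length. Multiple edges and self-loops are allowed and
connectedness is not required here. The edge `e` is parametrized by `[0, len e]`, with `0` glued to
`src e` and `len e` glued to `tgt e`. -/
structure LengthGraph (V E : Type*) where
  src : E → V
  tgt : E → V
  len : E → ℝ
  len_pos : ∀ e, 0 < len e

namespace LengthGraph

variable {V E : Type*} (Γ : LengthGraph V E)

/-- The disjoint union of the vertices and of the edge segments `[0, len e]`, before gluing. -/
abbrev Pieces : Type _ := V ⊕ (Σ e : E, Icc (0 : ℝ) (Γ.len e))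

/-- The gluing of the two end points of each segment to vertices. -/
inductive Glue : Γ.Pieces → Γ.Pieces → Prop
  | src (e : E) : Glue (Sum.inr ⟨e, ⟨0, left_mem_Icc.2 (Γ.len_pos e).le⟩⟩) (Sum.inl (Γ.src e))
  | tgt (e : E) :
      Glue (Sum.inr ⟨e, ⟨Γ.len e, right_mem_Icc.2 (Γ.len_pos e).le⟩⟩) (Sum.inl (Γ.tgt e))

/-- The geometric realization, with the quotient topology (vertices being discrete) and its Borel
σ-algebra. -/
def Point : Type _ := Quot Γ.Glue

instance : TopologicalSpace Γ.Pieces :=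
  @instTopologicalSpaceSum V (Σ e : E, Icc (0 : ℝ) (Γ.len e)) ⊥ inferInstance

instance : TopologicalSpace Γ.Point := inferInstanceAs (TopologicalSpace (Quot Γ.Glue))

instance : MeasurableSpace Γ.Point := borel Γ.Point

instance : BorelSpace Γ.Point := ⟨rfl⟩

/-- The point of the graph given by a vertex. -/
def vertex (v : V) : Γ.Point := Quot.mk _ (Sum.inl v)

/-- Arc length parametrization of the edge `e`; it is used for `t ∈ [0, len e]`, and other
parameters are projected to this interval. -/
noncomputable def pt (e : E) (t : ℝ) : Γ.Point :=
  Quot.mk _ (Sum.inr ⟨e, Set.projIcc 0 (Γ.len e) (Γ.len_pos e).le t⟩)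

/-- The graph obtained by deleting the interior of the edge `e`. -/
def delete (e : E) : LengthGraph V {e' : E // e' ≠ e} where
  src e' := Γ.src e'.1
  tgt e' := Γ.tgt e'.1
  len e' := Γ.len e'.1
  len_pos e' := Γ.len_pos e'.1

end LengthGraph

/-- The position `pos` on `edge`, together with one of the two orientations of that edge. -/
structure Direction (E : Type*) where
  edge : E
  pos : ℝ
  forward : Bool

namespace LengthGraph

variable {V E : Type*} (Γ : LengthGraph V E)

/-- The directions emanating from the point `p`. A self-loop at a vertex contributes two. -/
def directions (p : Γ.Point) : Set (Direction E) :=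
  {d | Γ.pt d.edge d.pos = p ∧
    d.pos ∈ (if d.forward then Ico 0 (Γ.len d.edge) else Ioc 0 (Γ.len d.edge))}

/-- The number of directions emanating from `p`. -/
noncomputable def valence (p : Γ.Point) : ℕ := (Γ.directions p).ncard

/-- The path leaving a point in the direction `d` at unit speed. -/
noncomputable def ray (d : Direction E) (s : ℝ) : Γ.Point :=
  Γ.pt d.edge (if d.forward then d.pos + s else d.pos - s)

/-- The one-sided directional derivative of `f` in the direction `d`. -/
noncomputable def slope (f : Γ.Point → ℝ) (d : Direction E) : ℝ :=
  derivWithin (fun s : ℝ => f (Γ.ray d s)) (Ici 0) 0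

/-- `f` is affine, with respect to arc length, near the interior point of parameter `t` of the
edge `e`. -/
def AffineNear (f : Γ.Point → ℝ) (e : E) (t : ℝ) : Prop :=
  ∃ m : ℝ, ∀ᶠ s in 𝓝 t, f (Γ.pt e s) = f (Γ.pt e t) + m * (s - t)

open Classical in
/-- `f` is the voltage `x ↦ j_z(x, y)` when unit current enters at `y` and exits at `z`, with
reference voltage `0` at `z`. That is, `f` is continuous, `f z = 0` and `Δ f = δ_y - δ_z`, where
`Δ f = - f'' dx - ∑_p (∑_{d at p} slope of f along d) δ_p` is computed with the vertex set enlarged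
by `y` and `z`. -/
structure IsVoltage (z y : Γ.Point) (f : Γ.Point → ℝ) : Prop where
  continuous : Continuous f
  reference : f z = 0
  affine : ∀ e : E, ∀ t ∈ Ioo 0 (Γ.len e), Γ.pt e t ≠ y → Γ.pt e t ≠ z → Γ.AffineNear f e t
  kirchhoff : ∀ p : Γ.Point,
    -(∑ᶠ d ∈ Γ.directions p, Γ.slope f d) =
      (if p = y then (1 : ℝ) else 0) - (if p = z then (1 : ℝ) else 0)

/-- The voltage function `j_z(x, y)`. -/
noncomputable def voltage (z x y : Γ.Point) : ℝ := Classical.epsilon (Γ.IsVoltage z y) x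

/-- The resistance function `r(x, y) = j_y(x, x)`. -/
noncomputable def resistance (x y : Γ.Point) : ℝ := Γ.voltage y x x

open Classical in
/-- The number `1 / (L_e + R_e)`, where `L_e` is the length of `e` and `R_e` is the resistance between
the end points of `e` after the interior of `e` has been deleted. For a bridge `R_e = ∞`, and
the number is `0`. (It is used for connected graphs.) -/
noncomputable def edgeDensity (e : E) : ℝ :=
  if ConnectedSpace (Γ.delete e).Point then
    1 / (Γ.len e +
      (Γ.delete e).resistance ((Γ.delete e).vertex (Γ.src e)) ((Γ.delete e).vertex (Γ.tgt e)))
  else 0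

/-- The total length. -/
noncomputable def totalLength [Fintype E] : ℝ := ∑ e, Γ.len e

/-- The graph cannot be disconnected by deleting a single point (vertex or not). -/
def Irreducible : Prop := ∀ p : Γ.Point, IsPreconnected ({p}ᶜ : Set Γ.Point)

end LengthGraph

/-- A metrized graph with a chosen vertex set `V` and edge set `E`: it is connected (in particular
non-empty); in use, `V` and `E` are finite. -/
structure MetrizedGraph (V E : Type*) extends LengthGraph V E where
  connected : ConnectedSpace toLengthGraph.Point

/-- A polarized metrized graph: `q` is a function from the vertices to `ℕ` such that the canonical
divisor `K = ∑_p (valence p - 2 + 2 q p) p` is effective. -/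
structure PMGraph (V E : Type*) extends MetrizedGraph V E where
  q : V → ℕ
  effective : ∀ v, 0 ≤ (toLengthGraph.valence (toLengthGraph.vertex v) : ℤ) - 2 + 2 * (q v : ℤ)

namespace PMGraph

variable {V E : Type*} (Γ : PMGraph V E)

/-- The coefficient of the canonical divisor `K` at a vertex. -/
noncomputable def canonicalDivisor (v : V) : ℤ :=
  (Γ.valence (Γ.vertex v) : ℤ) - 2 + 2 * (Γ.q v : ℤ)

variable [Fintype V] [Fintype E]

/-- The genus: the first Betti number of the graph plus the sum of the values of `q`. -/
def genus : ℤ :=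
  ((Fintype.card E : ℤ) - (Fintype.card V : ℤ) + 1) + ∑ v, (Γ.q v : ℤ)

/-- The admissible measure
`(1 / genus) * (∑_v q(v) δ_v + ∑_e dx / (L_e + R_e))`. -/
noncomputable def admissibleMeasure : Measure Γ.Point :=
  ENNReal.ofReal (1 / (Γ.genus : ℝ)) •
    ((∑ v, (Γ.q v : ENNReal) • Measure.dirac (Γ.vertex v)) +
      ∑ e, ENNReal.ofReal (Γ.edgeDensity e) •
        Measure.map (Γ.pt e) (volume.restrict (Icc 0 (Γ.len e))))

/-- `ε(Γ) = ∬ r(x, y) δ_K(x) μ_ad(y)`, where `δ_K = ∑_v K(v) δ_v`. -/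
noncomputable def epsilonInv : ℝ :=
  ∑ v, (Γ.canonicalDivisor v : ℝ) * ∫ y, Γ.resistance (Γ.vertex v) y ∂Γ.admissibleMeasure

/-- `a(Γ) = (1 / 2) ∬ r(x, y) μ_ad(x) μ_ad(y)`. -/
noncomputable def aInv : ℝ :=
  1 / 2 * ∫ y, ∫ x, Γ.resistance x y ∂Γ.admissibleMeasure ∂Γ.admissibleMeasure

/-- `φ(Γ) = 3 · genus · a(Γ) - (ε(Γ) + ℓ(Γ)) / 4`. -/
noncomputable def phi : ℝ :=
  3 * (Γ.genus : ℝ) * Γ.aInv - 1 / 4 * (Γ.epsilonInv + Γ.totalLength)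

end PMGraph

/-! The invariant depends only on the effective resistances r between vertices. Put ρ_e = r_e / L_e
and θ = Σ K(v) K(w) r(v, w), and let N = Σ_e ρ_e (δ_src + δ_tgt) - 2 Σ_v δ_v. This signed measure
has mass -2 (Foster's identity, `sum_kappa`), and its r-potential is a constant κ (`kappa_eq`). In
genus 3 the admissible measure, with the mass of each edge moved to its end points, is (K - N) / 6.
Hence φ = θ/12 - (13/12) κ + (13/36) Σ L_e (1 - ρ_e)² - ℓ/4 (`phi_eq`).

The lower bound combines three facts. The kernel r is of negative type, and applying this to N + K/2
gives κ ≤ -θ/8 (`kappa_le`). If K ≥ 1 at every vertex, then Σ K = 2·3 - 2 = 4 leaves at most four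
vertices, and a case distinction on edge multiplicities gives θ ≥ 2 Σ r_e
(`two_mul_sum_resistance_le`). What remains is edgewise: (7/16) ρ + (13/36) (1 - ρ)² has minimum 1/4
+ 183/3328, and 183/3328 exceeds the required constant. A vertex with K = 0 has valence two and q =
0; it can be erased, since the right side of the formula does not see subdivision
(`IsSeries.invariant`), so induction on the number of vertices applies.

The analytic half justifies the formula. Voltages on the topological graph exist as differences of
an explicit Green function (`kernel`) and are unique by the maximum principle (`IsVoltage.unique`).
On each edge the Green function is an affine interpolation plus the Dirichlet Green function of a
segment, so every integral reduces to that of a function quadratic along edges (`quad`). -/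

namespace LengthGraph

/-! ### Green functions and effective resistance of a finite network -/

variable {V E : Type*} (Γ : LengthGraph V E)

/-- The Dirichlet form of the network on functions of the vertices. -/
noncomputable def energy [Fintype E] (f g : V → ℝ) : ℝ :=
  ∑ e, (f (Γ.src e) - f (Γ.tgt e)) * (g (Γ.src e) - g (Γ.tgt e)) / Γ.len e

/-- Combinatorial connectedness: a function which is constant along the edges is constant. -/
def Conn : Prop := ∀ f : V → ℝ, (∀ e, f (Γ.src e) = f (Γ.tgt e)) → ∀ v w, f v = f w

/-- `G` is symmetric and inverts the Laplacian on functions of mean zero. -/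
structure IsGreen [Fintype V] [Fintype E] (G : V → V → ℝ) : Prop where
  symm : ∀ v w, G v w = G w v
  green : ∀ w f, Γ.energy f (fun v => G v w) = f w - (∑ v, f v) / Fintype.card V

/-- The characteristic properties of the effective resistance between vertices. -/
structure IsResistance [Fintype V] [Fintype E] (r : V → V → ℝ) : Prop where
  symm : ∀ v w, r v w = r w v
  self : ∀ v, r v v = 0
  laplace : ∀ y f, Γ.energy f (fun v => r v y) = 2 * ∑ v, f v - 2 * f y -
    ∑ e, r (Γ.src e) (Γ.tgt e) / Γ.len e * (f (Γ.src e) + f (Γ.tgt e))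
  neg : ∀ D : V → ℝ, ∑ v, D v = 0 → ∑ v, ∑ w, D v * D w * r v w ≤ 0

variable {Γ}

section
variable [Fintype E]

lemma energy_comm (f g : V → ℝ) : Γ.energy f g = Γ.energy g f := by
  unfold energy; refine Finset.sum_congr rfl fun e _ => ?_; ring

lemma energy_add_left (f g h : V → ℝ) : Γ.energy (f + g) h = Γ.energy f h + Γ.energy g h := by
  unfold energy; rw [← Finset.sum_add_distrib]; refine Finset.sum_congr rfl fun e _ => ?_
  simp only [Pi.add_apply]; ring

lemma energy_smul_left (c : ℝ) (f h : V → ℝ) : Γ.energy (c • f) h = c * Γ.energy f h := by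
  unfold energy; rw [Finset.mul_sum]; refine Finset.sum_congr rfl fun e _ => ?_
  simp only [Pi.smul_apply, smul_eq_mul]; ring

lemma energy_sub_right (f g h : V → ℝ) :
    Γ.energy f (fun v => g v - h v) = Γ.energy f g - Γ.energy f h := by
  unfold energy; rw [← Finset.sum_sub_distrib]; refine Finset.sum_congr rfl fun e _ => ?_
  ring

lemma energy_add_right (f g h : V → ℝ) :
    Γ.energy f (fun v => g v + h v) = Γ.energy f g + Γ.energy f h := by
  unfold energy; rw [← Finset.sum_add_distrib]; refine Finset.sum_congr rfl fun e _ => ?_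
  ring

lemma energy_mul_right (c : ℝ) (f g : V → ℝ) :
    Γ.energy f (fun v => c * g v) = c * Γ.energy f g := by
  unfold energy; rw [Finset.mul_sum]; refine Finset.sum_congr rfl fun e _ => ?_
  ring

lemma energy_const_right (f : V → ℝ) (c : ℝ) : Γ.energy f (fun _ => c) = 0 := by
  simp [energy]

lemma energy_sum_right {ι : Type*} (s : Finset ι) (f : V → ℝ) (c : ι → ℝ) (g : ι → V → ℝ) :
    Γ.energy f (fun v => ∑ i ∈ s, c i * g i v) = ∑ i ∈ s, c i * Γ.energy f (g i) := by
  unfold energy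
  simp_rw [Finset.mul_sum]
  rw [Finset.sum_comm]
  refine Finset.sum_congr rfl fun e _ => ?_
  rw [← Finset.sum_sub_distrib, Finset.mul_sum, Finset.sum_div]
  refine Finset.sum_congr rfl fun i _ => ?_
  ring

lemma energy_sum_left {ι : Type*} (s : Finset ι) (f : V → ℝ) (c : ι → ℝ) (g : ι → V → ℝ) :
    Γ.energy (fun v => ∑ i ∈ s, c i * g i v) f = ∑ i ∈ s, c i * Γ.energy (g i) f := by
  rw [energy_comm, energy_sum_right]
  exact Finset.sum_congr rfl fun i _ => by rw [energy_comm]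

lemma energy_self_nonneg (f : V → ℝ) : 0 ≤ Γ.energy f f :=
  Finset.sum_nonneg fun e _ => div_nonneg (mul_self_nonneg _) (Γ.len_pos e).le

lemma sq_div_len_le_energy (f : V → ℝ) (e : E) :
    (f (Γ.src e) - f (Γ.tgt e)) ^ 2 / Γ.len e ≤ Γ.energy f f := by
  rw [sq]
  exact Finset.single_le_sum (f := fun e => (f (Γ.src e) - f (Γ.tgt e)) *
    (f (Γ.src e) - f (Γ.tgt e)) / Γ.len e)
    (fun e _ => div_nonneg (mul_self_nonneg _) (Γ.len_pos e).le) (Finset.mem_univ e)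

lemma Conn.eq_of_energy_self (hΓ : Γ.Conn) {f : V → ℝ} (hf : Γ.energy f f ≤ 0) (v w : V) :
    f v = f w := by
  refine hΓ f (fun e => ?_) v w
  have h := (sq_div_len_le_energy f e).trans hf
  have h2 : (f (Γ.src e) - f (Γ.tgt e)) ^ 2 ≤ 0 := by
    by_contra! h3
    exact absurd h (not_le.2 (div_pos h3 (Γ.len_pos e)))
  exact sub_eq_zero.1 (pow_eq_zero_iff two_ne_zero |>.1 (le_antisymm h2 (sq_nonneg _)))

end

section
variable [Fintype V] [Fintype E]

lemma sum_const_of_conn (f : V → ℝ) (h : ∀ v w, f v = f w) (w : V) :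
    ∑ v, f v = Fintype.card V * f w := by
  rw [Finset.sum_congr rfl fun v _ => h v w]; simp

/-- The energy form degenerates exactly on constants, so adding the rank one form (Σ f)(Σ g) makes
it nondegenerate. The columns of G represent the evaluations at vertices for the enlarged form. -/
theorem Conn.exists_isGreen (hΓ : Γ.Conn) : ∃ G, Γ.IsGreen G := by
  classical
  cases isEmpty_or_nonempty V with
  | inl h => exact ⟨fun _ _ => 0, ⟨fun _ _ => rfl, fun w => h.elim w⟩⟩
  | inr h =>
  obtain ⟨v₀⟩ := h
  have hn : (Fintype.card V : ℝ) ≠ 0 := by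
    have : Nonempty V := ⟨v₀⟩
    exact_mod_cast Fintype.card_ne_zero
  let B : (V → ℝ) →ₗ[ℝ] Module.Dual ℝ (V → ℝ) := LinearMap.mk₂ ℝ
    (fun f g => Γ.energy f g + (∑ v, f v) * ∑ v, g v)
    (fun f f' g => by
      simp only [energy_add_left, Pi.add_apply, Finset.sum_add_distrib]; ring)
    (fun c f g => by
      simp only [energy_smul_left, Pi.smul_apply, smul_eq_mul, ← Finset.mul_sum]; ring)
    (fun f g g' => by
      simp only [energy_comm f, energy_add_left, Pi.add_apply, Finset.sum_add_distrib]; ring)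
    (fun c f g => by
      simp only [energy_comm f, energy_smul_left, Pi.smul_apply, smul_eq_mul, ← Finset.mul_sum]
      ring)
  have hB : ∀ f g, B f g = Γ.energy f g + (∑ v, f v) * ∑ v, g v := fun f g => rfl
  have hinj : Function.Injective B := by
    rw [← LinearMap.ker_eq_bot, LinearMap.ker_eq_bot']
    intro f hf
    have h0 : Γ.energy f f + (∑ v, f v) * ∑ v, f v = 0 := by rw [← hB, hf]; rfl
    have h1 := energy_self_nonneg (Γ := Γ) f
    have h2 : (∑ v, f v) * ∑ v, f v = 0 := by
      have := mul_self_nonneg (∑ v, f v); linarith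
    have h3 := hΓ.eq_of_energy_self (f := f) (by linarith)
    funext w
    have h4 := sum_const_of_conn f h3 w
    rw [mul_self_eq_zero.1 h2] at h4
    simpa [hn] using h4.symm
  have hsurj : Function.Surjective B := by
    refine (LinearMap.injective_iff_surjective_of_finrank_eq_finrank ?_).1 hinj
    rw [Subspace.dual_finrank_eq]
  choose g hg using fun w => hsurj (LinearMap.proj w)
  have hg' : ∀ w f, Γ.energy f (g w) + (∑ v, f v) * ∑ v, g w v = f w := fun w f => by
    have := congrArg (fun l => l f) (hg w)
    simp only [hB, LinearMap.proj_apply] at this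
    rw [energy_comm, mul_comm, this]
  -- Testing the representing property against the constant 1 removes the energy.
  have hsum : ∀ w, ∑ v, g w v = 1 / Fintype.card V := fun w => by
    have := hg' w (fun _ => 1)
    rw [energy_comm, energy_const_right] at this
    simp at this
    field_simp
    linarith
  refine ⟨fun v w => g w v, fun v w => ?_, fun w f => ?_⟩
  · rw [← hg' v (g w), ← hg' w (g v), energy_comm]; ring
  · have := hg' w f
    rw [hsum] at this
    rw [← this]; ring

variable {G : V → V → ℝ}

/-- The double sum is the energy of Σ_w D w G(·, w); the mean value term in `green` disappears
because D has total mass zero. -/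
lemma IsGreen.quadratic_nonneg (hG : Γ.IsGreen G) (D : V → ℝ) (hD : ∑ v, D v = 0) :
    0 ≤ ∑ v, ∑ w, D v * D w * G v w := by
  have h := energy_self_nonneg (Γ := Γ) (fun v => ∑ w, D w * G v w)
  rw [energy_sum_right Finset.univ _ D (fun w v => G v w)] at h
  simp_rw [hG.green, mul_sub, Finset.sum_sub_distrib, ← Finset.sum_mul, hD, zero_mul, sub_zero,
    Finset.mul_sum] at h
  refine h.trans_eq (Finset.sum_congr rfl fun v _ => Finset.sum_congr rfl fun w _ => ?_)
  ring

/-- Linear functionals agree with their expansion in the standard basis. -/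
lemma sum_single_mul [DecidableEq V] (f : V → ℝ) : f = fun v => ∑ w, f w * (if v = w then 1 else 0) := by
  funext v; simp

theorem IsGreen.isResistance (hG : Γ.IsGreen G) :
    Γ.IsResistance (fun v w => G v v + G w w - 2 * G v w) := by
  classical
  set r : V → V → ℝ := fun v w => G v v + G w w - 2 * G v w with hr
  have hC : ∀ y f, Γ.energy f (fun v => r v y) =
      Γ.energy f (fun v => G v v) - 2 * f y + 2 * ((∑ v, f v) / Fintype.card V) := fun y f => by
    simp only [hr]
    rw [energy_sub_right, energy_add_right, energy_const_right, energy_mul_right, hG.green]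
    ring
  have hsymm : ∀ v w, r v w = r w v := fun v w => by simp only [hr]; rw [hG.symm v w]; ring
  have hself : ∀ v, r v v = 0 := fun v => by simp only [hr]; ring
  -- The Laplacian of the diagonal v ↦ G v v is found by placing the pole at v itself: since r v v =
  -- 0, the indicator of v then sees only the resistances of the edges at v.
  have hs : ∀ v : V, Γ.energy (fun u => if u = v then 1 else 0) (fun v => G v v) +
      2 * (1 / Fintype.card V) = 2 - ∑ e, r (Γ.src e) (Γ.tgt e) / Γ.len e *
        ((if Γ.src e = v then 1 else 0) + (if Γ.tgt e = v then 1 else 0)) := fun v => by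
    have h := hC v (fun u => if u = v then 1 else 0)
    simp only [if_true, Finset.sum_ite_eq', Finset.mem_univ] at h
    have h2 : Γ.energy (fun u => if u = v then 1 else 0) (fun u => r u v) =
      - ∑ e, r (Γ.src e) (Γ.tgt e) / Γ.len e *
        ((if Γ.src e = v then 1 else 0) + (if Γ.tgt e = v then 1 else 0)) := by
      unfold energy
      rw [← Finset.sum_neg_distrib]
      refine Finset.sum_congr rfl fun e _ => ?_
      by_cases h1 : Γ.src e = v <;> by_cases h2 : Γ.tgt e = v <;> simp [h1, h2, hself]
      · rw [hsymm v]; ring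
      · ring
    rw [h2] at h
    linarith
  refine ⟨hsymm, hself, fun y f => ?_, fun D hD => ?_⟩
  · rw [hC]
    have h : Γ.energy f (fun v => G v v) + 2 * ((∑ v, f v) / Fintype.card V) =
        ∑ v, f v * (Γ.energy (fun u => if u = v then 1 else 0) (fun v => G v v) +
          2 * (1 / Fintype.card V)) := by
      conv_lhs => rw [sum_single_mul f]
      rw [energy_sum_left Finset.univ _ f (fun w v => if v = w then 1 else 0)]
      simp only [mul_add, Finset.sum_add_distrib, ← Finset.sum_mul]
      simp
      ring
    simp_rw [hs, mul_sub, Finset.sum_sub_distrib, Finset.mul_sum] at h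
    rw [Finset.sum_comm] at h
    have h2 : ∑ e, ∑ v, f v * (r (Γ.src e) (Γ.tgt e) / Γ.len e *
        ((if Γ.src e = v then 1 else 0) + (if Γ.tgt e = v then 1 else 0))) =
        ∑ e, r (Γ.src e) (Γ.tgt e) / Γ.len e * (f (Γ.src e) + f (Γ.tgt e)) := by
      refine Finset.sum_congr rfl fun e _ => ?_
      simp only [mul_add, Finset.sum_add_distrib]
      simp
      ring
    rw [h2, ← Finset.sum_mul] at h
    linarith
  · have h := hG.quadratic_nonneg D hD
    have h1 : ∑ v, ∑ w, D v * D w * r v w = -2 * ∑ v, ∑ w, D v * D w * G v w := by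
      have h2 : ∑ v, ∑ w, D v * D w * r v w = (∑ v, D v * G v v) * ∑ w, D w +
          (∑ v, D v) * (∑ w, D w * G w w) - 2 * ∑ v, ∑ w, D v * D w * G v w := by
        rw [Finset.sum_mul_sum, Finset.sum_mul_sum, Finset.mul_sum, ← Finset.sum_add_distrib,
          ← Finset.sum_sub_distrib]
        refine Finset.sum_congr rfl fun v _ => ?_
        rw [Finset.mul_sum, ← Finset.sum_add_distrib, ← Finset.sum_sub_distrib]
        refine Finset.sum_congr rfl fun w _ => ?_
        simp only [hr]; ring
      rw [h2, hD]; ring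
    linarith

/-! ### Metric properties of effective resistance; deletion of an edge -/

namespace IsResistance
variable {r : V → V → ℝ} (hr : Γ.IsResistance r)
include hr

/-- The part of `laplace` independent of the pole cancels: the difference is, up to a constant,
twice the voltage of a unit current entering at z and leaving at y. -/
lemma energy_sub (f : V → ℝ) (y z : V) :
    Γ.energy f (fun v => r v y - r v z) = 2 * f z - 2 * f y := by
  rw [energy_sub_right, hr.laplace, hr.laplace]; ring

lemma nonneg (v w : V) : 0 ≤ r v w := by
  have h := energy_self_nonneg (Γ := Γ) (fun u => r u v - r u w)
  rw [hr.energy_sub, hr.self, hr.self, hr.symm w v] at h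
  linarith

/-- For poles at the ends of e, the voltage difference has total energy 4r, of which the edge e
alone accounts for (2r)² / L. -/
lemma le_len (e : E) : r (Γ.src e) (Γ.tgt e) ≤ Γ.len e := by
  have h := sq_div_len_le_energy (Γ := Γ) (fun u => r u (Γ.src e) - r u (Γ.tgt e)) e
  rw [hr.energy_sub, hr.self, hr.self, hr.symm (Γ.tgt e), div_le_iff₀ (Γ.len_pos e)] at h
  by_contra! h2
  have := Γ.len_pos e
  nlinarith

/-- A maximum principle: h = r(·, c) - r(·, b) cannot exceed its value r(c, b) at the source b. The
excess f vanishes at both poles, so its energy against h is zero, and truncation makes its own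
energy no larger. -/
lemma triangle (hΓ : Γ.Conn) (a b c : V) : r a c ≤ r a b + r b c := by
  set h : V → ℝ := fun v => r v c - r v b with hh
  set f : V → ℝ := fun v => max (h v - r c b) 0 with hf
  have hc : f c = 0 := by
    have := hr.nonneg c b
    simp only [hf, hh, hr.self]; exact max_eq_right (by linarith)
  have hb : f b = 0 := by
    simp only [hf, hh, hr.self, hr.symm b c]; exact max_eq_right (by linarith)
  have h1 : Γ.energy f h = 0 := by rw [hr.energy_sub, hc, hb]; ring
  have h2 : Γ.energy f f ≤ Γ.energy f h := by
    refine Finset.sum_le_sum fun e _ => div_le_div_of_nonneg_right ?_ (Γ.len_pos e).le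
    simp only [hf]
    rcases le_total (h (Γ.src e) - r c b) 0 with h1 | h1 <;>
    rcases le_total (h (Γ.tgt e) - r c b) 0 with h2 | h2 <;>
    simp only [max_eq_left, max_eq_right, h1, h2] <;> nlinarith
  have h3 := hΓ.eq_of_energy_self (h2.trans h1.le) a c
  rw [hc] at h3
  have h4 : h a - r c b ≤ 0 := h3 ▸ le_max_left _ _
  simp only [hh] at h4
  rw [hr.symm b c]
  linarith

/-- The potential of the canonical measure of the network is constant. -/
lemma kappa_eq (y z : V) :
    ∑ e, r (Γ.src e) (Γ.tgt e) / Γ.len e * (r (Γ.src e) y + r (Γ.tgt e) y) - 2 * ∑ v, r v y =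
    ∑ e, r (Γ.src e) (Γ.tgt e) / Γ.len e * (r (Γ.src e) z + r (Γ.tgt e) z) - 2 * ∑ v, r v z := by
  -- The energy of the columns at y and z is computed in two ways; the terms 2 r(y, z) agree, so the
  -- remainders do too.
  have h1 := hr.laplace y (fun v => r v z)
  have h2 := hr.laplace z (fun v => r v y)
  rw [energy_comm, h2, hr.symm z y] at h1
  linarith

-- The parallel law r = R L / (R + L): restoring the edge multiplies the current driven by the
-- voltage of the deleted graph by 1 + R / L, so the two voltages are proportional up to a constant.
open Classical in
lemma delete_formula (hΓ : Γ.Conn) (e₀ : E) [Fintype {e // e ≠ e₀}] {r' : V → V → ℝ}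
    (hr' : (Γ.delete e₀).IsResistance r') :
    (1 - r (Γ.src e₀) (Γ.tgt e₀) / Γ.len e₀) / Γ.len e₀ =
      1 / (Γ.len e₀ + r' (Γ.src e₀) (Γ.tgt e₀)) := by
  have hE : ∀ f g, Γ.energy f g = (Γ.delete e₀).energy f g +
      (f (Γ.src e₀) - f (Γ.tgt e₀)) * (g (Γ.src e₀) - g (Γ.tgt e₀)) / Γ.len e₀ := fun f g => by
    unfold energy
    rw [← Finset.add_sum_erase _ _ (Finset.mem_univ e₀), add_comm]
    congr 1
    exact Finset.sum_subtype (Finset.univ.erase e₀) (p := fun e => e ≠ e₀) (by simp)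
      (fun e => (f (Γ.src e) - f (Γ.tgt e)) * (g (Γ.src e) - g (Γ.tgt e)) / Γ.len e)
  set a := Γ.src e₀ with ha
  set b := Γ.tgt e₀ with hb
  have hL := Γ.len_pos e₀
  have hR := hr'.nonneg a b
  set R := r' a b with hRdef
  set L := Γ.len e₀ with hLdef
  have hLR : 0 < 1 + R / L := by positivity
  set h' : V → ℝ := fun v => r' v a - r' v b with hh'
  set d : V → ℝ := fun v => (r v a - r v b) - (1 / (1 + R / L)) * h' v with hd
  have h1 : ∀ f, Γ.energy f h' = (1 + R / L) * (2 * f b - 2 * f a) := fun f => by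
    rw [hE, hr'.energy_sub]
    simp only [hh', hr'.self, hr'.symm b a]
    ring
  have h2 : ∀ f, Γ.energy f d = 0 := fun f => by
    simp only [hd]
    rw [LengthGraph.energy_sub_right, energy_mul_right, h1, hr.energy_sub]
    field_simp
    ring
  have h3 := hΓ.eq_of_energy_self (h2 d).le a b
  simp only [hd, hh', hr.self, hr'.self, hr.symm b a, hr'.symm b a] at h3
  rw [← hRdef] at h3
  have h4 : r a b = R / (1 + R / L) := by
    field_simp at h3 ⊢
    linarith
  rw [h4]
  field_simp
  ring

/-- A bridge carries the whole current. A nonconstant function that is constant along all other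
edges detects only the drop across e₀ when used as a test function. -/
lemma eq_len_of_delete_not_conn (hΓ : Γ.Conn) (e₀ : E) (h : ¬ (Γ.delete e₀).Conn) :
    r (Γ.src e₀) (Γ.tgt e₀) = Γ.len e₀ := by
  unfold Conn at h
  push Not at h
  obtain ⟨f, hf, v, w, hvw⟩ := h
  have h1 : f (Γ.src e₀) ≠ f (Γ.tgt e₀) := fun h1 => hvw <| hΓ f (fun e => by
    by_cases he : e = e₀
    · rw [he, h1]
    · exact hf ⟨e, he⟩) v w
  have h2 := hr.energy_sub f (Γ.src e₀) (Γ.tgt e₀)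
  unfold energy at h2
  rw [Finset.sum_eq_single e₀ (fun e _ he => by
    have : f (Γ.src e) = f (Γ.tgt e) := hf ⟨e, he⟩
    simp [this]) (by simp)] at h2
  simp only [hr.self, hr.symm (Γ.tgt e₀)] at h2
  have hL := Γ.len_pos e₀
  have h3 : f (Γ.src e₀) - f (Γ.tgt e₀) ≠ 0 := sub_ne_zero.2 h1
  rw [div_eq_iff hL.ne'] at h2
  have h4 : (f (Γ.src e₀) - f (Γ.tgt e₀)) * (2 * (r (Γ.src e₀) (Γ.tgt e₀) - Γ.len e₀)) = 0 := by
    linarith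
  have := (mul_eq_zero.1 h4).resolve_left h3
  linarith

end IsResistance
end
end LengthGraph
-- Multiplicities, and comparison of the canonical self-pairing with edge resistances
namespace LengthGraph

variable {V E : Type*} (Γ : LengthGraph V E)

section
variable [Fintype E]

open Classical in
/-- The number of ends of edges at a vertex. -/
noncomputable def deg (v : V) : ℕ :=
  ∑ e, ((if Γ.src e = v then 1 else 0) + (if Γ.tgt e = v then 1 else 0))

open Classical in
/-- The entries of the adjacency matrix; a loop counts twice. -/
noncomputable def mult (v w : V) : ℕ :=
  ∑ e, ((if Γ.src e = v ∧ Γ.tgt e = w then 1 else 0) +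
    (if Γ.src e = w ∧ Γ.tgt e = v then 1 else 0))

/-- The edge `e` joins `v` and `w`. -/
def Joins (e : E) (v w : V) : Prop :=
  (Γ.src e = v ∧ Γ.tgt e = w) ∨ (Γ.src e = w ∧ Γ.tgt e = v)

variable {Γ}

lemma mult_comm (v w : V) : Γ.mult v w = Γ.mult w v := by
  unfold mult; exact Finset.sum_congr rfl fun e _ => add_comm _ _

lemma even_mult_self (v : V) : Even (Γ.mult v v) := by
  unfold mult; rw [Finset.sum_add_distrib]
  exact ⟨_, rfl⟩

open Classical in
lemma mult_eq_card {v w : V} (h : v ≠ w) :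
    Γ.mult v w = (Finset.univ.filter fun e => Γ.Joins e v w).card := by
  rw [Finset.card_filter]
  refine Finset.sum_congr rfl fun e _ => ?_
  unfold Joins
  by_cases h1 : Γ.src e = v <;> by_cases h2 : Γ.tgt e = w <;> by_cases h3 : Γ.src e = w <;>
    by_cases h4 : Γ.tgt e = v <;> simp_all

lemma exists_joins {v w : V} (h : v ≠ w) (hm : 1 ≤ Γ.mult v w) : ∃ e, Γ.Joins e v w := by
  classical
  rw [mult_eq_card h, Finset.one_le_card] at hm
  obtain ⟨e, he⟩ := hm
  exact ⟨e, (Finset.mem_filter.1 he).2⟩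

lemma joins_unique {v w : V} (h : v ≠ w) (hm : Γ.mult v w ≤ 1) {e e' : E}
    (he : Γ.Joins e v w) (he' : Γ.Joins e' v w) : e = e' := by
  classical
  rw [mult_eq_card h, Finset.card_le_one] at hm
  exact hm e (by simp [he]) e' (by simp [he'])

lemma one_le_mult (e : E) : 1 ≤ Γ.mult (Γ.src e) (Γ.tgt e) := by
  classical
  unfold mult
  rw [← Finset.add_sum_erase _ _ (Finset.mem_univ e)]
  simp; omega

lemma Joins.one_le_mult {e : E} {v w : V} (h : Γ.Joins e v w) : 1 ≤ Γ.mult v w := by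
  rcases h with ⟨rfl, rfl⟩ | ⟨rfl, rfl⟩
  · exact LengthGraph.one_le_mult e
  · rw [mult_comm]; exact LengthGraph.one_le_mult e

lemma Conn.exists_mult (hΓ : Γ.Conn) (S : Set V) {a b : V} (ha : a ∈ S) (hb : b ∉ S) :
    ∃ p ∈ S, ∃ q ∉ S, 1 ≤ Γ.mult p q := by
  classical
  by_contra! h
  have := hΓ (fun v => if v ∈ S then 1 else 0) (fun e => by
    by_cases h1 : Γ.src e ∈ S <;> by_cases h2 : Γ.tgt e ∈ S <;> simp only [h1, h2, if_true, if_false]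
    · have := h _ h1 _ h2
      have := LengthGraph.one_le_mult (Γ := Γ) e
      omega
    · have := h _ h2 _ h1
      have := LengthGraph.one_le_mult (Γ := Γ) e
      rw [mult_comm] at this
      omega) a b
  simp [ha, hb] at this

end

section
variable {Γ} [Fintype V] [Fintype E]

lemma sum_deg_mul (f : V → ℝ) :
    ∑ v, (Γ.deg v : ℝ) * f v = ∑ e, (f (Γ.src e) + f (Γ.tgt e)) := by
  classical
  unfold deg
  push_cast
  simp_rw [Finset.sum_mul]
  rw [Finset.sum_comm]
  refine Finset.sum_congr rfl fun e _ => ?_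
  simp [add_mul, Finset.sum_add_distrib]

lemma sum_mult (v : V) : ∑ w, Γ.mult v w = Γ.deg v := by
  classical
  unfold mult deg
  rw [Finset.sum_comm]
  refine Finset.sum_congr rfl fun e _ => ?_
  rw [Finset.sum_add_distrib]
  congr 1
  · by_cases h : Γ.src e = v <;> simp [h]
  · by_cases h : Γ.tgt e = v <;> simp [h]

lemma sum_mult_mul (f : V → V → ℝ) (hf : ∀ v w, f v w = f w v) :
    ∑ v, ∑ w, (Γ.mult v w : ℝ) * f v w = 2 * ∑ e, f (Γ.src e) (Γ.tgt e) := by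
  classical
  unfold mult
  push_cast
  simp_rw [Finset.sum_mul]
  rw [Finset.sum_congr rfl fun v _ => Finset.sum_comm, Finset.sum_comm, Finset.mul_sum]
  refine Finset.sum_congr rfl fun e _ => ?_
  have h1 : ∀ v w : V, (if Γ.src e = v ∧ Γ.tgt e = w then (1 : ℝ) else 0) =
    (if Γ.src e = v then 1 else 0) * (if Γ.tgt e = w then 1 else 0) := fun v w => by
      by_cases h1 : Γ.src e = v <;> by_cases h2 : Γ.tgt e = w <;> simp [h1, h2]
  simp_rw [h1, add_mul, Finset.sum_add_distrib, mul_assoc, ← Finset.mul_sum]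
  have h2 : ∀ v w : V, (if Γ.src e = w then (1 : ℝ) else 0) * ((if Γ.tgt e = v then 1 else 0) * f v w) =
    (if Γ.tgt e = v then (1 : ℝ) else 0) * ((if Γ.src e = w then 1 else 0) * f v w) := fun v w => by ring
  simp_rw [h2, ← Finset.mul_sum]
  simp [hf (Γ.tgt e)]
  ring

variable {r : V → V → ℝ}

/-- The function h = r(·, b) - r(·, d) drives a current 2 from d to b, all of which crosses the cut
{a, b} | {c, d}. By `le_len` the single b–d edge carries at most 2. If the inequality failed, then h
a > h c, and the a–c edges would carry a positive current backwards, leaving less than 2 in total.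
-/
lemma IsResistance.cut_inequality (hr : Γ.IsResistance r) {a b c d : V} (hab : a ≠ b)
    (hac : a ≠ c) (had : a ≠ d) (hbc : b ≠ c) (hbd : b ≠ d) (hV : ∀ v, v = a ∨ v = b ∨ v = c ∨ v = d)
    (h1 : 1 ≤ Γ.mult a c) (h2 : Γ.mult b d = 1) (h3 : Γ.mult a d = 0) (h4 : Γ.mult b c = 0) :
    r a b + r c d ≤ r a d + r b c := by
  classical
  set h : V → ℝ := fun v => r v b - r v d with hh
  set f : V → ℝ := fun v => if v = a ∨ v = b then 1 else 0 with hf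
  set T : E → ℝ := fun e => (f (Γ.src e) - f (Γ.tgt e)) * (h (Γ.src e) - h (Γ.tgt e)) / Γ.len e
    with hT
  have fa : f a = 1 := by simp [hf]
  have fb : f b = 1 := by simp [hf]
  have fc : f c = 0 := by simp [hf, hac.symm, hbc.symm]
  have fd : f d = 0 := by simp [hf, had.symm, hbd.symm]
  have hE : ∑ e, T e = -2 := by
    have := hr.energy_sub f b d
    rw [fb, fd] at this
    simp only [energy] at this
    simp only [hT, hh]; linarith
  obtain ⟨e₁, he₁⟩ := exists_joins hac h1
  obtain ⟨e₂, he₂⟩ := exists_joins hbd h2.ge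
  have hb : h b = - r b d := by simp [hh, hr.self]
  have hd : h d = r b d := by simp [hh, hr.self, hr.symm d b]
  by_contra! hcon
  have hpos : 0 < h a - h c := by
    simp only [hh]; rw [hr.symm c b]; linarith
  have T1 : ∀ e, Γ.Joins e a c → 0 < T e := fun e he => by
    have := Γ.len_pos e
    rcases he with ⟨p, q⟩ | ⟨p, q⟩ <;> simp only [hT, p, q, fa, fc]
    · have : 0 < (h a - h c) / Γ.len e := by positivity
      simpa using this
    · have : 0 < (h a - h c) / Γ.len e := by positivity
      convert this using 1; ring
  have T2 : -2 ≤ T e₂ := by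
    have hL := Γ.len_pos e₂
    have hle := hr.le_len e₂
    rcases he₂ with ⟨p, q⟩ | ⟨p, q⟩ <;> simp only [hT, p, q, fb, fd, hb, hd] <;>
      rw [p, q] at hle <;> rw [le_div_iff₀ hL]
    · linarith
    · rw [hr.symm] at hle; linarith
  have T3 : ∀ e, e ≠ e₂ → 0 ≤ T e := fun e he => by
    have hbd' : ¬ Γ.Joins e b d := fun hj => he (joins_unique hbd h2.le hj he₂)
    have had' : ¬ Γ.Joins e a d := fun hj => by have := hj.one_le_mult; omega
    have hbc' : ¬ Γ.Joins e b c := fun hj => by have := hj.one_le_mult; omega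
    by_cases hac' : Γ.Joins e a c
    · exact (T1 e hac').le
    · have : f (Γ.src e) = f (Γ.tgt e) := by
        unfold Joins at *
        rcases hV (Γ.src e) with p | p | p | p <;> rcases hV (Γ.tgt e) with q | q | q | q <;>
          rw [p, q] <;> simp_all
      simp [hT, this]
  have hne : e₁ ≠ e₂ := by
    rintro rfl
    rcases he₁ with ⟨p, q⟩ | ⟨p, q⟩ <;> rcases he₂ with ⟨p', q'⟩ | ⟨p', q'⟩
    · exact hab (p.symm.trans p')
    · exact had (p.symm.trans p')
    · exact hbc (p'.symm.trans p)
    · exact hab (q.symm.trans q')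
  have := Finset.sum_le_sum_of_subset_of_nonneg (f := T) (Finset.subset_univ {e₁, e₂})
    (fun e _ he => T3 e (by rintro rfl; simp at he))
  rw [Finset.sum_pair hne, hE] at this
  linarith [T1 e₁ he₁]

/-- Enumerates the multiplicities on four vertices with deg + 2q = 3 everywhere and a multiple edge
between the first two. Loops and q both enter evenly and are absorbed in ea, …, ed; the other
hypotheses come from connectedness. -/
lemma star_four_arith {x y z u v w ea eb ec ed : ℕ} (ha : x + y + z + 2 * ea = 3)
    (hb : x + u + v + 2 * eb = 3) (hc : y + u + w + 2 * ec = 3) (hd : z + v + w + 2 * ed = 3)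
    (cab : 1 ≤ y + z + u + v) (cc : 1 ≤ y + u + w) (cd : 1 ≤ z + v + w) (hx : 2 ≤ x) :
    x = 2 ∧ ((y = 1 ∧ z = 0 ∧ u = 1 ∧ v = 0 ∧ w = 1) ∨ (y = 1 ∧ z = 0 ∧ u = 0 ∧ v = 1 ∧ w = 0) ∨
      (y = 1 ∧ z = 0 ∧ u = 0 ∧ v = 1 ∧ w = 2) ∨ (y = 0 ∧ z = 1 ∧ u = 1 ∧ v = 0 ∧ w = 0) ∨
      (y = 0 ∧ z = 1 ∧ u = 1 ∧ v = 0 ∧ w = 2) ∨ (y = 0 ∧ z = 1 ∧ u = 0 ∧ v = 1 ∧ w = 1)) := by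
  have hx3 : x ≠ 3 := by
    rintro rfl
    have : y = 0 := by omega
    have : z = 0 := by omega
    omega
  have hx2 : x = 2 := by omega
  subst hx2
  have hea : ea = 0 := by omega
  have heb : eb = 0 := by omega
  subst hea heb
  have hy : y ≤ 1 := by omega
  have hu : u ≤ 1 := by omega
  have hw : w ≤ 3 := by omega
  interval_cases y <;> interval_cases u <;> interval_cases w <;> omega

section star
variable (hr : Γ.IsResistance r) (hΓ : Γ.Conn) {q K : V → ℕ}
  (hK : ∀ v, Γ.deg v + 2 * q v = K v + 2)
include hr hΓ hK

/-- Only a double edge has a negative coefficient. Its resistance is compensated by the triangle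
inequality along a detour through pairs that are not joined, except when ab and cd are both double
and linked by two disjoint edges; that case is `cut_inequality`. -/
lemma star_four_aux (hK1 : ∀ v, K v = 1) {a b c d : V} (hab : a ≠ b) (hac : a ≠ c) (had : a ≠ d)
    (hbc : b ≠ c) (hbd : b ≠ d) (hcd : c ≠ d)
    (hN : ∀ f : V → ℕ, ∑ v, f v = f a + f b + f c + f d)
    (hV : ∀ v, v = a ∨ v = b ∨ v = c ∨ v = d) (hm : 2 ≤ Γ.mult a b) :
    0 ≤ (1 - (Γ.mult a b : ℝ)) * r a b + (1 - (Γ.mult a c : ℝ)) * r a c +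
      (1 - (Γ.mult a d : ℝ)) * r a d + (1 - (Γ.mult b c : ℝ)) * r b c +
      (1 - (Γ.mult b d : ℝ)) * r b d + (1 - (Γ.mult c d : ℝ)) * r c d := by
  have da := sum_mult (Γ := Γ) a
  have db := sum_mult (Γ := Γ) b
  have dc := sum_mult (Γ := Γ) c
  have dd := sum_mult (Γ := Γ) d
  rw [hN] at da db dc dd
  have ka := hK a
  have kb := hK b
  have kc := hK c
  have kd := hK d
  rw [hK1] at ka kb kc kd
  rw [mult_comm b a] at db
  rw [mult_comm c a, mult_comm c b] at dc
  rw [mult_comm d a, mult_comm d b, mult_comm d c] at dd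
  obtain ⟨ea, hea⟩ := even_mult_self (Γ := Γ) a
  obtain ⟨eb, heb⟩ := even_mult_self (Γ := Γ) b
  obtain ⟨ec, hec⟩ := even_mult_self (Γ := Γ) c
  obtain ⟨ed, hed⟩ := even_mult_self (Γ := Γ) d
  have cab : 1 ≤ Γ.mult a c + Γ.mult a d + Γ.mult b c + Γ.mult b d := by
    obtain ⟨p, hp, q, hq, hpq⟩ := hΓ.exists_mult {a, b} (a := a) (b := c) (by simp)
      (by simp [hac.symm, hbc.symm])
    simp only [mem_insert_iff, mem_singleton_iff, not_or] at hp hq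
    rcases hV q with rfl | rfl | rfl | rfl
    · simp_all
    · simp_all
    · rcases hp with rfl | rfl <;> omega
    · rcases hp with rfl | rfl <;> omega
  have cd : 1 ≤ Γ.mult a d + Γ.mult b d + Γ.mult c d := by
    obtain ⟨p, hp, q, hq, hpq⟩ := hΓ.exists_mult {d} (a := d) (b := c) (by simp)
      (by simp [hcd])
    simp only [mem_singleton_iff] at hp hq
    subst hp
    rw [mult_comm] at hpq
    rcases hV q with rfl | rfl | rfl | rfl
    · omega
    · omega
    · omega
    · simp_all
  have cc : 1 ≤ Γ.mult a c + Γ.mult b c + Γ.mult c d := by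
    obtain ⟨p, hp, q, hq, hpq⟩ := hΓ.exists_mult {c} (a := c) (b := d) (by simp)
      (by simp [hcd.symm])
    simp only [mem_singleton_iff] at hp hq
    subst hp
    rcases hV q with rfl | rfl | rfl | rfl
    · rw [mult_comm] at hpq; omega
    · rw [mult_comm] at hpq; omega
    · simp_all
    · omega
  obtain ⟨hab2, hcases⟩ := star_four_arith (x := Γ.mult a b) (y := Γ.mult a c) (z := Γ.mult a d)
    (u := Γ.mult b c) (v := Γ.mult b d) (w := Γ.mult c d) (ea := ea + q a) (eb := eb + q b)
    (ec := ec + q c) (ed := ed + q d) (by omega) (by omega) (by omega) (by omega) cab cc cd hm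
  have t1 := hr.triangle hΓ a c b
  have t2 := hr.triangle hΓ a d b
  have t3 := hr.triangle hΓ a c d
  have t4 := hr.triangle hΓ a d c
  rw [hr.symm c b] at t1
  rw [hr.symm d b] at t2
  rw [hr.symm d c] at t4
  have n1 := hr.nonneg a b
  have n2 := hr.nonneg a c
  have n3 := hr.nonneg a d
  have n4 := hr.nonneg b c
  have n5 := hr.nonneg b d
  have n6 := hr.nonneg c d
  rw [hab2]
  rcases hcases with ⟨p1, p2, p3, p4, p5⟩ | ⟨p1, p2, p3, p4, p5⟩ | ⟨p1, p2, p3, p4, p5⟩ |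
    ⟨p1, p2, p3, p4, p5⟩ | ⟨p1, p2, p3, p4, p5⟩ | ⟨p1, p2, p3, p4, p5⟩
  · rw [p1, p2, p3, p4, p5]; push_cast; linarith
  · rw [p1, p2, p3, p4, p5]; push_cast; linarith
  · have := hr.cut_inequality hab hac had hbc hbd hV p1.ge p4 p2 p3
    rw [p1, p2, p3, p4, p5]; push_cast; linarith
  · rw [p1, p2, p3, p4, p5]; push_cast; linarith
  · have := hr.cut_inequality hab had hac hbd hbc (fun v => by have := hV v; tauto) p2.ge p3 p1 p4
    rw [hr.symm d c] at this
    rw [p1, p2, p3, p4, p5]; push_cast; linarith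
  · rw [p1, p2, p3, p4, p5]; push_cast; linarith

/-- The degrees bound the multiplicities so tightly that each negative coefficient is compensated by
one triangle inequality; connectedness excludes a triple edge between b and c. -/
lemma star_three_aux {a b c : V} (hab : a ≠ b) (hac : a ≠ c) (hbc : b ≠ c)
    (ha : K a = 2) (hb : K b = 1) (hc : K c = 1)
    (hN : ∀ f : V → ℕ, ∑ v, f v = f a + f b + f c)
    (hV : ∀ v, v = a ∨ v = b ∨ v = c) :
    0 ≤ (2 - (Γ.mult a b : ℝ)) * r a b + (2 - (Γ.mult a c : ℝ)) * r a c +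
      (1 - (Γ.mult b c : ℝ)) * r b c := by
  have da := sum_mult (Γ := Γ) a
  have db := sum_mult (Γ := Γ) b
  have dc := sum_mult (Γ := Γ) c
  rw [hN] at da db dc
  have ka := hK a
  have kb := hK b
  have kc := hK c
  rw [ha] at ka
  rw [hb] at kb
  rw [hc] at kc
  rw [mult_comm b a] at db
  rw [mult_comm c a, mult_comm c b] at dc
  have caa : 1 ≤ Γ.mult a b + Γ.mult a c := by
    obtain ⟨p, hp, q, hq, hpq⟩ := hΓ.exists_mult {a} (a := a) (b := c) (by simp)
      (by simp [hac.symm])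
    simp only [mem_singleton_iff] at hp hq
    subst hp
    rcases hV q with rfl | rfl | rfl
    · simp_all
    · omega
    · omega
  have t1 := hr.triangle hΓ a c b
  have t2 := hr.triangle hΓ a b c
  have t3 := hr.triangle hΓ b a c
  rw [hr.symm c b] at t1
  rw [hr.symm b a] at t3
  have n1 := hr.nonneg a b
  have n2 := hr.nonneg a c
  have n4 := hr.nonneg b c
  generalize Γ.mult a b = x at *
  generalize Γ.mult a c = y at *
  generalize Γ.mult b c = z at *
  have hx : x ≤ 3 := by omega
  have hy : y ≤ 3 := by omega
  have hz : z ≤ 3 := by omega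
  interval_cases x <;> interval_cases y <;> interval_cases z <;> first | omega | (push_cast; linarith)

end star

/-- If all coefficients of the canonical divisor are positive, its self-pairing dominates the sum
of the resistances of the edges. -/
theorem two_mul_sum_resistance_le (hr : Γ.IsResistance r) (hΓ : Γ.Conn) {q K : V → ℕ}
    (hK : ∀ v, Γ.deg v + 2 * q v = K v + 2) (hpos : ∀ v, 1 ≤ K v) (hsum : ∑ v, K v = 4) :
    2 * ∑ e, r (Γ.src e) (Γ.tgt e) ≤ ∑ v, ∑ w, (K v : ℝ) * K w * r v w := by
  -- The claim becomes Σ (K v K w - mult v w) r v w ≥ 0, where loops play no role because r v v = 0.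
  -- Positivity of K with total 4 then leaves at most four vertices.
  rw [← sum_mult_mul r hr.symm, ← sub_nonneg, ← Finset.sum_sub_distrib]
  simp_rw [← Finset.sum_sub_distrib, ← sub_mul]
  have hcard : Fintype.card V ≤ 4 := by
    rw [← hsum, ← Finset.card_univ, Finset.card_eq_sum_ones]
    exact Finset.sum_le_sum fun v _ => hpos v
  have φ := (Fintype.equivFin V).symm
  generalize Fintype.card V = n at φ hcard
  have hS : ∀ {M : Type} [AddCommMonoid M] (f : V → M), ∑ v, f v = ∑ i, f (φ i) :=
    fun f => (Equiv.sum_comp φ f).symm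
  have hne : ∀ i j, i ≠ j → φ i ≠ φ j := fun i j h => φ.injective.ne h
  have hVV : ∀ v, ∃ i, v = φ i := fun v => ⟨φ.symm v, by simp⟩
  interval_cases n
  · simp [hS]
  · simp [hS, hr.self]
  · set a := φ 0
    set b := φ 1
    have hN : ∀ {M : Type} [AddCommMonoid M] (f : V → M), ∑ v, f v = f a + f b :=
      fun f => by rw [hS, Fin.sum_univ_two]
    have ks := hsum
    have ka := hK a
    have kb := hK b
    have da := sum_mult (Γ := Γ) a
    have db := sum_mult (Γ := Γ) b
    rw [hN] at ks da db
    rw [hN, hN, hN, hr.self, hr.self, hr.symm b a]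
    rw [mult_comm b a] at *
    have pa := hpos a
    have pb := hpos b
    -- The multiplicity is at most min (K a) (K b) + 2, which for K a + K b = 4 is exactly the
    -- product in each of the splittings 1 + 3 and 2 + 2.
    have hm : Γ.mult a b ≤ K a * K b := by
      have h1 : Γ.mult a b ≤ K a + 2 := by omega
      have h2 : Γ.mult a b ≤ K b + 2 := by omega
      generalize Γ.mult a b = x at *
      generalize K a = y at *
      generalize K b = z at *
      have : y ≤ 3 := by omega
      interval_cases y
      · omega
      · omega
      · omega
    have hm' : (Γ.mult a b : ℝ) ≤ K a * K b := by exact_mod_cast hm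
    have := mul_nonneg (sub_nonneg.2 hm') (hr.nonneg a b)
    linarith
  · set a := φ 0
    set b := φ 1
    set c := φ 2
    have hN : ∀ {M : Type} [AddCommMonoid M] (f : V → M), ∑ v, f v = f a + f b + f c :=
      fun f => by rw [hS, Fin.sum_univ_three]
    have hab : a ≠ b := hne _ _ (by decide)
    have hac : a ≠ c := hne _ _ (by decide)
    have hbc : b ≠ c := hne _ _ (by decide)
    have hV : ∀ v, v = a ∨ v = b ∨ v = c := fun v => by
      obtain ⟨i, rfl⟩ := hVV v
      fin_cases i <;> simp [a, b, c]
    have ks := hsum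
    rw [hN] at ks
    have pa := hpos a
    have pb := hpos b
    have pc := hpos c
    have hcases : K a = 2 ∧ K b = 1 ∧ K c = 1 ∨ K b = 2 ∧ K a = 1 ∧ K c = 1 ∨
      K c = 2 ∧ K a = 1 ∧ K b = 1 := by omega
    simp only [hN, hr.self, hr.symm b a, hr.symm c a, hr.symm c b, mult_comm b a, mult_comm c a,
      mult_comm c b]
    rcases hcases with ⟨h1, h2, h3⟩ | ⟨h1, h2, h3⟩ | ⟨h1, h2, h3⟩
    · have := star_three_aux hr hΓ hK hab hac hbc h1 h2 h3 (fun f => hN f) hV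
      rw [h1, h2, h3]; push_cast; linarith
    · have := star_three_aux hr hΓ hK hab.symm hbc hac h1 h2 h3 (fun f => by rw [hN]; ring)
        (fun v => by have := hV v; tauto)
      rw [hr.symm b a, mult_comm b a] at this
      rw [h1, h2, h3]; push_cast; linarith
    · have := star_three_aux hr hΓ hK hac.symm hbc.symm hab h1 h2 h3 (fun f => by rw [hN]; ring)
        (fun v => by have := hV v; tauto)
      rw [hr.symm c a, mult_comm c a, hr.symm c b, mult_comm c b] at this
      rw [h1, h2, h3]; push_cast; linarith
  · set a := φ 0
    set b := φ 1
    set c := φ 2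
    set d := φ 3
    have hN : ∀ {M : Type} [AddCommMonoid M] (f : V → M), ∑ v, f v = f a + f b + f c + f d :=
      fun f => by rw [hS, Fin.sum_univ_four]
    have hab : a ≠ b := hne _ _ (by decide)
    have hac : a ≠ c := hne _ _ (by decide)
    have had : a ≠ d := hne _ _ (by decide)
    have hbc : b ≠ c := hne _ _ (by decide)
    have hbd : b ≠ d := hne _ _ (by decide)
    have hcd : c ≠ d := hne _ _ (by decide)
    have hV : ∀ v, v = a ∨ v = b ∨ v = c ∨ v = d := fun v => by
      obtain ⟨i, rfl⟩ := hVV v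
      fin_cases i <;> simp [a, b, c, d]
    have ks := hsum
    rw [hN] at ks
    have K1 : ∀ v, K v = 1 := by
      have pa := hpos a
      have pb := hpos b
      have pc := hpos c
      have pd := hpos d
      intro v
      rcases hV v with rfl | rfl | rfl | rfl <;> omega
    simp only [hN, hr.self, K1, hr.symm b a, hr.symm c a, hr.symm c b, hr.symm d a, hr.symm d b,
      hr.symm d c, mult_comm b a, mult_comm c a, mult_comm c b, mult_comm d a, mult_comm d b,
      mult_comm d c]
    suffices h : 0 ≤ (1 - (Γ.mult a b : ℝ)) * r a b + (1 - (Γ.mult a c : ℝ)) * r a c +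
      (1 - (Γ.mult a d : ℝ)) * r a d + (1 - (Γ.mult b c : ℝ)) * r b c +
      (1 - (Γ.mult b d : ℝ)) * r b d + (1 - (Γ.mult c d : ℝ)) * r c d by
      push_cast; linarith
    -- A pair joined by a multiple edge is relabelled as the first pair of `star_four_aux`; if there
    -- is none, every summand is nonnegative.
    by_cases m1 : 2 ≤ Γ.mult a b
    · exact star_four_aux hr hΓ hK K1 hab hac had hbc hbd hcd (fun f => hN f) hV m1
    by_cases m2 : 2 ≤ Γ.mult a c
    · have := star_four_aux hr hΓ hK K1 hac hab had hbc.symm hcd hbd (fun f => by rw [hN]; ring)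
        (fun v => by have := hV v; tauto) m2
      rw [hr.symm c b, mult_comm c b] at this
      linarith
    by_cases m3 : 2 ≤ Γ.mult a d
    · have := star_four_aux hr hΓ hK K1 had hab hac hbd.symm hcd.symm hbc
        (fun f => by rw [hN]; ring) (fun v => by have := hV v; tauto) m3
      rw [hr.symm d b, mult_comm d b, hr.symm d c, mult_comm d c] at this
      linarith
    by_cases m4 : 2 ≤ Γ.mult b c
    · have := star_four_aux hr hΓ hK K1 hbc hab.symm hbd hac.symm hcd had
        (fun f => by rw [hN]; ring) (fun v => by have := hV v; tauto) m4
      rw [hr.symm b a, mult_comm b a, hr.symm c a, mult_comm c a] at this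
      linarith
    by_cases m5 : 2 ≤ Γ.mult b d
    · have := star_four_aux hr hΓ hK K1 hbd hab.symm hbc had.symm hcd.symm hac
        (fun f => by rw [hN]; ring) (fun v => by have := hV v; tauto) m5
      rw [hr.symm b a, mult_comm b a, hr.symm d a, mult_comm d a, hr.symm d c, mult_comm d c] at this
      linarith
    by_cases m6 : 2 ≤ Γ.mult c d
    · have := star_four_aux hr hΓ hK K1 hcd hac.symm hbc.symm had.symm hbd.symm hab
        (fun f => by rw [hN]; ring) (fun v => by have := hV v; tauto) m6
      rw [hr.symm c a, mult_comm c a, hr.symm c b, mult_comm c b, hr.symm d a, mult_comm d a,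
        hr.symm d b, mult_comm d b] at this
      linarith
    have key : ∀ v w, ¬ 2 ≤ Γ.mult v w → 0 ≤ (1 - (Γ.mult v w : ℝ)) * r v w := fun v w h =>
      mul_nonneg (by
        have : Γ.mult v w ≤ 1 := by omega
        have : (Γ.mult v w : ℝ) ≤ 1 := by exact_mod_cast this
        linarith) (hr.nonneg v w)
    linarith [key _ _ m1, key _ _ m2, key _ _ m3, key _ _ m4, key _ _ m5, key _ _ m6]

end
end LengthGraph
-- Negative type and the bound for a positive canonical divisor
namespace LengthGraph

section
variable {V E : Type*} {Γ : LengthGraph V E}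

lemma Joins.apply_symm {M : Type*} {S : V → V → M} (hS : ∀ p q, S p q = S q p) {e : E} {v w : V}
    (h : Γ.Joins e v w) : S (Γ.src e) (Γ.tgt e) = S v w := by
  rcases h with ⟨rfl, rfl⟩ | ⟨rfl, rfl⟩
  · rfl
  · exact hS _ _

lemma Joins.symm {e : E} {v w : V} (h : Γ.Joins e v w) : Γ.Joins e w v := Or.symm h

variable [Fintype V] [Fintype E] {r : V → V → ℝ}

lemma IsResistance.sum_kappa (hr : Γ.IsResistance r) [Nonempty V] :
    ∑ e, r (Γ.src e) (Γ.tgt e) / Γ.len e * 2 = 2 * Fintype.card V - 2 := by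
  have h := hr.laplace (Classical.arbitrary V) (fun _ => 1)
  rw [energy_comm, energy_const_right] at h
  norm_num at h
  linarith

/-- Negative type is applied to N + K/2, which has mass -2 + 2 = 0. As N has constant potential κ,
the quadratic form equals -2κ + 4κ + θ/4. -/
lemma IsResistance.kappa_le (hr : Γ.IsResistance r) (K : V → ℝ) (hK : ∑ v, K v = 4) (y : V) :
    ∑ e, r (Γ.src e) (Γ.tgt e) / Γ.len e * (r (Γ.src e) y + r (Γ.tgt e) y) - 2 * ∑ v, r v y ≤
      - (∑ v, ∑ w, K v * K w * r v w) / 8 := by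
  classical
  have : Nonempty V := ⟨y⟩
  set κ := ∑ e, r (Γ.src e) (Γ.tgt e) / Γ.len e * (r (Γ.src e) y + r (Γ.tgt e) y) -
    2 * ∑ v, r v y with hκ
  set N : V → ℝ := fun v => (∑ e, r (Γ.src e) (Γ.tgt e) / Γ.len e *
    ((if Γ.src e = v then 1 else 0) + (if Γ.tgt e = v then 1 else 0))) - 2 with hN
  have hNf : ∀ f : V → ℝ, ∑ v, N v * f v =
      ∑ e, r (Γ.src e) (Γ.tgt e) / Γ.len e * (f (Γ.src e) + f (Γ.tgt e)) - 2 * ∑ v, f v := by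
    intro f
    simp only [hN, sub_mul, Finset.sum_sub_distrib, ← Finset.mul_sum, Finset.sum_mul]
    rw [Finset.sum_comm]
    congr 1
    refine Finset.sum_congr rfl fun e _ => ?_
    simp [mul_assoc, ← Finset.mul_sum, add_mul, Finset.sum_add_distrib]
  have hNr : ∀ w, ∑ v, N v * r v w = κ := fun w => by
    rw [hNf, hκ]; exact hr.kappa_eq w y
  have hN1 : ∑ v, N v = -2 := by
    have := hNf (fun _ => 1)
    simp only [mul_one] at this
    rw [this]
    have := hr.sum_kappa
    norm_num at this ⊢
    linarith
  have h := hr.neg (fun v => N v + K v / 2) (by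
    rw [Finset.sum_add_distrib, ← Finset.sum_div, hN1, hK]; norm_num)
  have h2 : ∑ v, ∑ w, (N v + K v / 2) * (N w + K w / 2) * r v w =
      ∑ w, N w * (∑ v, N v * r v w) + ∑ w, K w * (∑ v, N v * r v w) +
        (∑ v, ∑ w, K v * K w * r v w) / 4 := by
    have h3 : ∑ v, ∑ w, N w * K v * r v w = ∑ v, ∑ w, N v * K w * r v w := by
      rw [Finset.sum_comm]
      exact Finset.sum_congr rfl fun v _ => Finset.sum_congr rfl fun w _ => by rw [hr.symm]
    have h4 : ∀ A : V → ℝ, ∑ w, A w * (∑ v, N v * r v w) = ∑ v, ∑ w, N v * A w * r v w := by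
      intro A
      rw [Finset.sum_comm]
      refine Finset.sum_congr rfl fun w _ => ?_
      rw [Finset.mul_sum]
      exact Finset.sum_congr rfl fun v _ => by ring
    rw [h4, h4]
    have h5 : ∑ v, ∑ w, (N v + K v / 2) * (N w + K w / 2) * r v w =
        ∑ v, ∑ w, N v * N w * r v w + (∑ v, ∑ w, N v * K w * r v w) / 2 +
        (∑ v, ∑ w, N w * K v * r v w) / 2 + (∑ v, ∑ w, K v * K w * r v w) / 4 := by
      simp only [Finset.sum_div, ← Finset.sum_add_distrib]
      exact Finset.sum_congr rfl fun v _ => Finset.sum_congr rfl fun w _ => by ring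
    rw [h5, h3]; ring
  rw [h2] at h
  simp_rw [hNr, ← Finset.sum_mul, hN1, hK] at h
  linarith

/-- The lower bound when all coefficients of the canonical divisor are positive. -/
lemma network_bound_of_pos (hr : Γ.IsResistance r) (hΓ : Γ.Conn) {q K : V → ℕ}
    (hK : ∀ v, Γ.deg v + 2 * q v = K v + 2) (hpos : ∀ v, 1 ≤ K v) (hsum : ∑ v, K v = 4) (y : V) :
    (1 / 4 + 183 / 3328) * ∑ e, Γ.len e ≤ (∑ v, ∑ w, (K v : ℝ) * K w * r v w) / 12 -
      13 / 12 * (∑ e, r (Γ.src e) (Γ.tgt e) / Γ.len e * (r (Γ.src e) y + r (Γ.tgt e) y) -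
        2 * ∑ v, r v y) +
      13 / 36 * ∑ e, Γ.len e * (1 - r (Γ.src e) (Γ.tgt e) / Γ.len e) ^ 2 := by
  have h1 := two_mul_sum_resistance_le hr hΓ hK hpos hsum
  have h2 := hr.kappa_le (fun v => (K v : ℝ)) (by exact_mod_cast hsum) y
  -- With κ ≤ -θ/8 the coefficient of θ is 1/12 + 13/96 = 7/32, and θ ≥ 2 Σ r_e turns this into
  -- 7/16.
  have h3 : (1 / 4 + 183 / 3328) * ∑ e, Γ.len e ≤ 7 / 16 * ∑ e, r (Γ.src e) (Γ.tgt e) +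
      13 / 36 * ∑ e, Γ.len e * (1 - r (Γ.src e) (Γ.tgt e) / Γ.len e) ^ 2 := by
    rw [Finset.mul_sum, Finset.mul_sum, Finset.mul_sum, ← Finset.sum_add_distrib]
    refine Finset.sum_le_sum fun e _ => ?_
    have hL := Γ.len_pos e
    obtain ⟨ρ, hρ⟩ : ∃ ρ, r (Γ.src e) (Γ.tgt e) = Γ.len e * ρ :=
      ⟨r (Γ.src e) (Γ.tgt e) / Γ.len e, by field_simp⟩
    rw [hρ, mul_div_cancel_left₀ _ hL.ne']
    -- Completing the square: 41/104 minimizes (7/16) ρ + (13/36) (1 - ρ)², with minimal value 1/4 +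
    -- 183/3328.
    have : 0 ≤ Γ.len e * (13 / 36 * (ρ - 41 / 104) ^ 2) := by positivity
    linarith
  linarith

end

/-! ### Removing a vertex of valence two -/

section contract
variable {V E : Type*} (Γ : LengthGraph V E)

open Classical in
/-- The retraction which moves the vertex `x` to `b`. -/
noncomputable def retract {x : V} (b : {v : V // v ≠ x}) (v : V) : {v : V // v ≠ x} :=
  if h : v = x then b else ⟨v, h⟩

lemma retract_self {x : V} (b : {v : V // v ≠ x}) : retract b x = b := by simp [retract]

lemma retract_of_ne {x : V} (b : {v : V // v ≠ x}) {v : V} (h : v ≠ x) : retract b v = ⟨v, h⟩ := by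
  simp [retract, h]

open Classical in
/-- Remove the vertex `x` of valence two by contracting `e₂`, an edge from `x` to `b`, and adding its
length to the other edge `e₁` at `x`. -/
noncomputable def contract {x : V} (b : {v : V // v ≠ x}) (e₁ e₂ : E) :
    LengthGraph {v : V // v ≠ x} {e : E // e ≠ e₂} where
  src e := retract b (Γ.src e)
  tgt e := retract b (Γ.tgt e)
  len e := if e = e₁ then Γ.len e₁ + Γ.len e₂ else Γ.len e
  len_pos e := by
    have h1 := Γ.len_pos e₁
    have h2 := Γ.len_pos e₂
    have h3 := Γ.len_pos e
    split_ifs <;> linarith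

variable {Γ}

/-- The lost and gained terms stand on opposite sides so that no subtraction is needed; the identity
then also serves for degrees in ℕ. -/
lemma sum_contract [Fintype E] {e₁ e₂ : E} (h : e₁ ≠ e₂) [Fintype {e : E // e ≠ e₂}] {M : Type*}
    [AddCommMonoid M] (T : E → M) (T' : {e : E // e ≠ e₂} → M)
    (hT : ∀ e : {e : E // e ≠ e₂}, (e : E) ≠ e₁ → T' e = T e) :
    ∑ e, T' e + (T e₁ + T e₂) = ∑ e, T e + T' ⟨e₁, h⟩ := by
  classical
  have h1 : ∑ e, T' e = T' ⟨e₁, h⟩ + ∑ e ∈ Finset.univ.erase ⟨e₁, h⟩, T' e :=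
    (Finset.add_sum_erase _ _ (Finset.mem_univ _)).symm
  have h2 : ∑ e, T e = T e₁ + (T e₂ + ∑ e ∈ (Finset.univ.erase e₁).erase e₂, T e) := by
    rw [Finset.add_sum_erase _ _ (by simp [h.symm]), Finset.add_sum_erase _ _ (Finset.mem_univ _)]
  have h3 : ∑ e ∈ Finset.univ.erase (⟨e₁, h⟩ : {e : E // e ≠ e₂}), T' e =
      ∑ e ∈ (Finset.univ.erase e₁).erase e₂, T e := by
    refine Finset.sum_bij (fun e _ => e.1) ?_ ?_ ?_ ?_
    · intro e he
      have := e.2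
      simp only [Finset.mem_erase, Finset.mem_univ, and_true, ne_eq] at he ⊢
      exact ⟨this, fun h => he (Subtype.ext h)⟩
    · intro e _ e' _ h; exact Subtype.ext h
    · intro e he
      simp only [Finset.mem_erase, Finset.mem_univ, and_true, ne_eq] at he
      exact ⟨⟨e, he.1⟩, by simpa [Subtype.ext_iff] using he.2, rfl⟩
    · intro e he
      simp only [Finset.mem_erase, Finset.mem_univ, and_true, ne_eq] at he
      exact hT e (fun h => he (Subtype.ext h))
  rw [h1, h2, h3]
  abel

/-- The vertex `x` has exactly two edges, `e₁` to `a` and `e₂` to `b`. -/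
structure IsSeries (Γ : LengthGraph V E) (x : V) (a b : {v : V // v ≠ x}) (e₁ e₂ : E) : Prop where
  ne : e₁ ≠ e₂
  joins₁ : Γ.Joins e₁ a x
  joins₂ : Γ.Joins e₂ x b
  src_ne : ∀ e, e ≠ e₁ → e ≠ e₂ → Γ.src e ≠ x
  tgt_ne : ∀ e, e ≠ e₁ → e ≠ e₂ → Γ.tgt e ≠ x

namespace IsSeries
variable {x : V} {a b : {v : V // v ≠ x}} {e₁ e₂ : E} (hx : Γ.IsSeries x a b e₁ e₂)
include hx

lemma contract_src (e : {e : E // e ≠ e₂}) (he : (e : E) ≠ e₁) :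
    (((Γ.contract b e₁ e₂).src e : {v : V // v ≠ x}) : V) = Γ.src e := by
  show ((retract b (Γ.src e) : {v : V // v ≠ x}) : V) = _
  rw [retract_of_ne _ (hx.src_ne e he e.2)]

lemma contract_tgt (e : {e : E // e ≠ e₂}) (he : (e : E) ≠ e₁) :
    (((Γ.contract b e₁ e₂).tgt e : {v : V // v ≠ x}) : V) = Γ.tgt e := by
  show ((retract b (Γ.tgt e) : {v : V // v ≠ x}) : V) = _
  rw [retract_of_ne _ (hx.tgt_ne e he e.2)]

omit hx in
lemma contract_len (e : {e : E // e ≠ e₂}) (he : (e : E) ≠ e₁) :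
    (Γ.contract b e₁ e₂).len e = Γ.len e := by simp [contract, he]

omit hx in
lemma contract_len_self (h : e₁ ≠ e₂) :
    (Γ.contract b e₁ e₂).len ⟨e₁, h⟩ = Γ.len e₁ + Γ.len e₂ := by simp [contract]

lemma contract_joins : (Γ.contract b e₁ e₂).Joins ⟨e₁, hx.ne⟩ a b := by
  rcases hx.joins₁ with ⟨h1, h2⟩ | ⟨h1, h2⟩
  · left
    simp only [contract, h1, h2, retract_self, retract_of_ne _ a.2]
    simp
  · right
    simp only [contract, h1, h2, retract_self, retract_of_ne _ a.2]
    simp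

lemma contract_conn (hΓ : Γ.Conn) : (Γ.contract b e₁ e₂).Conn := by
  intro f hf v w
  have h := hΓ (fun v => f (retract b v)) (fun e => by
    by_cases he : e = e₂
    · subst he
      rcases hx.joins₂ with ⟨h1, h2⟩ | ⟨h1, h2⟩ <;>
        simp only [h1, h2, retract_self, retract_of_ne _ b.2]
    · exact hf ⟨e, he⟩) v w
  simpa only [retract_of_ne _ v.2, retract_of_ne _ w.2] using h

variable [Fintype E] [Fintype {e : E // e ≠ e₂}]

omit hx in
lemma sum_subtype_ne [Fintype V] [Fintype {v : V // v ≠ x}] {M : Type*} [AddCommMonoid M] (f : V → M) :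
    f x + ∑ v : {v : V // v ≠ x}, f v = ∑ v, f v := by
  classical
  rw [← Finset.add_sum_erase _ _ (Finset.mem_univ x)]
  congr 1
  exact (Finset.sum_subtype (Finset.univ.erase x) (p := fun v => v ≠ x) (by simp) f).symm

/-- Sums over the edges of a symmetric function of the end points and of the length. -/
lemma sum_symm {M : Type*} [AddCommMonoid M] (S : V → V → ℝ → M)
    (hS : ∀ p q l, S p q l = S q p l) :
    ∑ e, S ((Γ.contract b e₁ e₂).src e).1 ((Γ.contract b e₁ e₂).tgt e).1
        ((Γ.contract b e₁ e₂).len e) + (S a x (Γ.len e₁) + S x b (Γ.len e₂)) =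
      ∑ e, S (Γ.src e) (Γ.tgt e) (Γ.len e) + S a b (Γ.len e₁ + Γ.len e₂) := by
  have h := sum_contract hx.ne (M := M) (fun e => S (Γ.src e) (Γ.tgt e) (Γ.len e))
    (fun e => S ((Γ.contract b e₁ e₂).src e).1 ((Γ.contract b e₁ e₂).tgt e).1
      ((Γ.contract b e₁ e₂).len e))
    (fun e he => by rw [hx.contract_src e he, hx.contract_tgt e he, contract_len e he])
  rw [contract_len_self,
    hx.joins₁.apply_symm (S := fun p q => S p q (Γ.len e₁)) (fun p q => hS p q _),
    hx.joins₂.apply_symm (S := fun p q => S p q (Γ.len e₂)) (fun p q => hS p q _),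
    hx.contract_joins.apply_symm (S := fun (p q : {v : V // v ≠ x}) => S p.1 q.1 (Γ.len e₁ + Γ.len e₂))
      (fun p q => hS p q _)] at h
  exact h

lemma contract_deg (v : {v : V // v ≠ x}) : (Γ.contract b e₁ e₂).deg v = Γ.deg v := by
  classical
  have h := hx.sum_symm (fun p q _ => (if p = v then 1 else 0) + (if q = v then 1 else 0))
    (fun p q _ => add_comm _ _)
  simp only [v.2.symm, if_false] at h
  unfold deg
  simp only [Subtype.ext_iff]
  omega

variable [Fintype V] [Fintype {v : V // v ≠ x}] {r : V → V → ℝ} (hr : Γ.IsResistance r)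
include hr

-- Kirchhoff's law at x: `laplace` tested on the indicator of x, which sees only e₁ and e₂.
omit [Fintype {v : V // v ≠ x}] [Fintype {e : E // e ≠ e₂}] in
lemma resistance_laplace (y : {v : V // v ≠ x}) :
    (r x y - r a y) / Γ.len e₁ + (r x y - r b y) / Γ.len e₂ =
      2 - (r a x / Γ.len e₁ + r x b / Γ.len e₂) := by
  classical
  have h := hr.laplace y (fun v => if v = x then 1 else 0)
  simp only [y.2, if_false, Finset.sum_ite_eq', Finset.mem_univ, if_true] at h
  unfold energy at h
  have hs : ∀ T : E → ℝ, (∀ e, e ≠ e₁ → e ≠ e₂ → T e = 0) → ∑ e, T e = T e₁ + T e₂ := by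
    intro T hT
    rw [← Finset.sum_subset (Finset.subset_univ {e₁, e₂}) (fun e _ he => by
      simp only [Finset.mem_insert, Finset.mem_singleton, not_or] at he
      exact hT e he.1 he.2), Finset.sum_pair hx.ne]
  rw [hs _ (fun e h1 h2 => by simp [hx.src_ne e h1 h2, hx.tgt_ne e h1 h2]),
    hs _ (fun e h1 h2 => by simp [hx.src_ne e h1 h2, hx.tgt_ne e h1 h2]),
    hx.joins₁.apply_symm (S := fun p q => ((if p = x then 1 else 0) - (if q = x then 1 else 0)) *
      (r p y - r q y) / Γ.len e₁) (fun p q => by ring),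
    hx.joins₂.apply_symm (S := fun p q => ((if p = x then 1 else 0) - (if q = x then 1 else 0)) *
      (r p y - r q y) / Γ.len e₂) (fun p q => by ring),
    hx.joins₁.apply_symm (S := fun p q => r p q / Γ.len e₁ *
      ((if p = x then 1 else 0) + (if q = x then 1 else 0)))
      (fun p q => by rw [hr.symm]; ring),
    hx.joins₂.apply_symm (S := fun p q => r p q / Γ.len e₂ *
      ((if p = x then 1 else 0) + (if q = x then 1 else 0)))
      (fun p q => by rw [hr.symm]; ring)] at h
  simp only [a.2, b.2, if_true, if_false] at h
  linear_combination h

-- Along the merged edge, r(·, y) is an affine interpolation plus a quadratic bulge independent of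
-- y.
omit [Fintype {v : V // v ≠ x}] [Fintype {e : E // e ≠ e₂}] in
lemma resistance_eq (y : {v : V // v ≠ x}) :
    r x y = (Γ.len e₂ * r a y + Γ.len e₁ * r b y) / (Γ.len e₁ + Γ.len e₂) +
      (1 - r a b / (Γ.len e₁ + Γ.len e₂)) * (Γ.len e₁ * Γ.len e₂ / (Γ.len e₁ + Γ.len e₂)) := by
  have h1 := hx.resistance_laplace hr y
  have h2 := hx.resistance_laplace hr a
  have h3 := hx.resistance_laplace hr b
  have l1 := Γ.len_pos e₁
  have l2 := Γ.len_pos e₂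
  rw [hr.self, hr.symm x a, hr.symm b a] at h2
  rw [hr.self] at h3
  generalize Γ.len e₁ = L₁ at *
  generalize Γ.len e₂ = L₂ at *
  have hL : L₁ + L₂ ≠ 0 := by positivity
  -- Combining Kirchhoff's law for the poles a and b gives the sum of the relative resistances of
  -- the two halves, the only unknown in the law for a general pole.
  have h4 : r a x / L₁ + r x b / L₂ = 1 + r a b / (L₁ + L₂) := by
    field_simp at h2 h3 ⊢
    have h5 : (L₁ + L₂) * ((L₂ * r a x + r x b * L₁) * (L₁ + L₂) - L₁ * L₂ * (L₁ + L₂ + r a b)) = 0 := by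
      linear_combination (L₁ * (L₁ + L₂) / 2) * h3 + (L₂ * (L₁ + L₂) / 2) * h2
    have := (mul_eq_zero.1 h5).resolve_left hL
    linarith
  rw [h4] at h1
  field_simp at h1 ⊢
  linear_combination h1

lemma contract_isResistance :
    (Γ.contract b e₁ e₂).IsResistance (fun v w => r v.1 w.1) where
  symm v w := hr.symm v w
  self v := hr.self v
  neg D hD := by
    classical
    have hne : ∀ v : {v : V // v ≠ x}, (v : V) = x ↔ False := fun v => iff_false_intro v.2
    have h := hr.neg (fun v => if h : v = x then 0 else D ⟨v, h⟩) (by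
      rw [← sum_subtype_ne (x := x)]
      simpa [hne] using hD)
    rw [← sum_subtype_ne (x := x)] at h
    simp_rw [← sum_subtype_ne (x := x) (f := fun w => _ * _ * r _ w)] at h
    simpa [hne] using h
  laplace y f := by
    -- The test function is extended to x by its value at b, so it does not vary along the
    -- contracted edge e₂.
    have h := hr.laplace y (fun v => f (retract b v))
    have l1 := Γ.len_pos e₁
    have l2 := Γ.len_pos e₂
    have h1 := hx.sum_symm (fun p q l => (f (retract b p) - f (retract b q)) * (r p y - r q y) / l)
      (fun p q l => by ring)
    have h2 := hx.sum_symm (fun p q l => r p q / l * (f (retract b p) + f (retract b q)))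
      (fun p q l => by rw [hr.symm]; ring)
    have h3 := sum_subtype_ne (x := x) (fun v => f (retract b v))
    have hf : ∀ v : {v : V // v ≠ x}, f (retract b v) = f v := fun v => by
      rw [retract_of_ne b v.2]
    simp only [hf, retract_self] at h h1 h2 h3
    unfold energy at h ⊢
    have e1 := hx.resistance_eq hr y
    have e2 := hx.resistance_eq hr a
    have e3 := hx.resistance_eq hr b
    rw [hr.self, hr.symm b a] at e2
    rw [hr.self] at e3
    rw [hr.symm a x, e2, e3] at h2
    rw [e1] at h1
    generalize Γ.len e₁ = L₁ at *
    generalize Γ.len e₂ = L₂ at *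
    have key : (f a - f b) * (r a y - r b y) / (L₁ + L₂) - (f a - f b) * (r a y -
      ((L₂ * r a y + L₁ * r b y) / (L₁ + L₂) + (1 - r a b / (L₁ + L₂)) * (L₁ * L₂ / (L₁ + L₂)))) / L₁
      = - 2 * f b - (r a b / (L₁ + L₂) * (f a + f b) -
        ((L₂ * 0 + L₁ * r a b) / (L₁ + L₂) + (1 - r a b / (L₁ + L₂)) * (L₁ * L₂ / (L₁ + L₂))) / L₁ *
          (f a + f b) - ((L₂ * r a b + L₁ * 0) / (L₁ + L₂) +
          (1 - r a b / (L₁ + L₂)) * (L₁ * L₂ / (L₁ + L₂))) / L₂ * (f b + f b)) := by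
      field_simp
      ring
    simp only [sub_self, zero_mul, zero_div] at h1
    linarith

/-- The bound is inherited from the network in which `x` has been removed. -/
lemma invariant {K : V → ℝ} (hK : K x = 0) :
    (∑ v, ∑ w, K v * K w * r v w) / 12 -
      13 / 12 * (∑ e, r (Γ.src e) (Γ.tgt e) / Γ.len e * (r (Γ.src e) b + r (Γ.tgt e) b) -
        2 * ∑ v, r v b) +
      13 / 36 * ∑ e, Γ.len e * (1 - r (Γ.src e) (Γ.tgt e) / Γ.len e) ^ 2 =
    (∑ v : {v : V // v ≠ x}, ∑ w : {v : V // v ≠ x}, K v * K w * r v w) / 12 -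
      13 / 12 * (∑ e, r ((Γ.contract b e₁ e₂).src e) ((Γ.contract b e₁ e₂).tgt e) /
          (Γ.contract b e₁ e₂).len e *
          (r ((Γ.contract b e₁ e₂).src e) b + r ((Γ.contract b e₁ e₂).tgt e) b) -
        2 * ∑ v : {v : V // v ≠ x}, r v b) +
      13 / 36 * ∑ e, (Γ.contract b e₁ e₂).len e *
        (1 - r ((Γ.contract b e₁ e₂).src e) ((Γ.contract b e₁ e₂).tgt e) /
          (Γ.contract b e₁ e₂).len e) ^ 2 := by
  have h0 : ∑ v, ∑ w, K v * K w * r v w =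
      ∑ v : {v : V // v ≠ x}, ∑ w : {v : V // v ≠ x}, K v * K w * r v w := by
    rw [← sum_subtype_ne (x := x)]
    simp_rw [← sum_subtype_ne (x := x) (f := fun w => _ * _ * r _ w)]
    simp [hK]
  have l1 := Γ.len_pos e₁
  have l2 := Γ.len_pos e₂
  have h1 := hx.sum_symm (fun p q l => r p q / l * (r p b + r q b))
    (fun p q l => by rw [hr.symm]; ring)
  have h2 := hx.sum_symm (fun p q l => l * (1 - r p q / l) ^ 2)
    (fun p q l => by rw [hr.symm])
  have h3 := sum_subtype_ne (x := x) (fun v => r v b)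
  have e2 := hx.resistance_eq hr a
  have e3 := hx.resistance_eq hr b
  rw [hr.self, hr.symm b a] at e2
  rw [hr.self] at e3
  simp only [hr.symm a x, hr.self] at h1 h2
  rw [e3] at h3
  rw [e2, e3] at h1 h2
  rw [h0]
  generalize Γ.len e₁ = L₁ at *
  generalize Γ.len e₂ = L₂ at *
  have hL : L₁ + L₂ ≠ 0 := by positivity
  -- In the variables ρ and t = L₂ / (L₁ + L₂) the halves have relative resistances ρ + (1 - ρ) t
  -- and ρ + (1 - ρ)(1 - t), and everything becomes polynomial.
  obtain ⟨ρ, hρ⟩ : ∃ ρ, r a b = (L₁ + L₂) * ρ := ⟨r a b / (L₁ + L₂), by field_simp⟩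
  rw [hρ] at h1 h2 h3
  rw [mul_div_cancel_left₀ _ hL] at h1 h2 h3
  have key1 : (L₂ * 0 + L₁ * ((L₁ + L₂) * ρ)) / (L₁ + L₂) + (1 - ρ) * (L₁ * L₂ / (L₁ + L₂)) =
    L₁ * (ρ + (1 - ρ) * (L₂ / (L₁ + L₂))) := by field_simp; ring
  have key2 : (L₂ * ((L₁ + L₂) * ρ) + L₁ * 0) / (L₁ + L₂) + (1 - ρ) * (L₁ * L₂ / (L₁ + L₂)) =
    L₂ * (ρ + (1 - ρ) * (L₁ / (L₁ + L₂))) := by field_simp; ring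
  rw [key1, key2, mul_div_cancel_left₀ _ l1.ne', mul_div_cancel_left₀ _ l2.ne'] at h1 h2
  rw [key2] at h3
  have key3 : L₁ / (L₁ + L₂) = 1 - L₂ / (L₁ + L₂) := by field_simp; ring
  have key4 : L₂ = (L₁ + L₂) * (L₂ / (L₁ + L₂)) := by field_simp
  have key5 : L₁ = (L₁ + L₂) * (1 - L₂ / (L₁ + L₂)) := by field_simp; ring
  rw [key3] at h1 h2 h3
  clear key1 key2 key3 e2 e3 l1 l2
  generalize L₂ / (L₁ + L₂) = t at *
  generalize L₁ + L₂ = L at *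
  subst key4 key5
  -- Subdividing lowers κ by L t (1 - t)(1 - ρ)² and the sum of squares by three times as much; the
  -- coefficients 13/12 and 13/36 are in the ratio 3 that makes the changes cancel.
  linear_combination (13 / 12) * h1 - (13 / 36) * h2 - (13 / 6) * h3

end IsSeries
end contract

/-- Some edge has exactly one end at x: otherwise x would be the only vertex, and Σ K would be 0.
Since deg x + 2 q x = 2, exactly one further edge end lies at x, and it too belongs to an edge that
is not a loop. -/
lemma exists_isSeries {V E : Type*} {Γ : LengthGraph V E} [Fintype V] [Fintype E] (hΓ : Γ.Conn)
    {q K : V → ℕ} (hK : ∀ v, Γ.deg v + 2 * q v = K v + 2) (hsum : ∑ v, K v = 4) {x : V}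
    (hx : K x = 0) : ∃ a b e₁ e₂, Γ.IsSeries x a b e₁ e₂ := by
  classical
  set n : E → ℕ := fun e => (if Γ.src e = x then 1 else 0) + (if Γ.tgt e = x then 1 else 0) with hn
  have hdeg : ∑ e, n e = Γ.deg x := rfl
  have hex : ∃ e, ¬ (Γ.src e = x ↔ Γ.tgt e = x) := by
    by_contra! h
    have h1 : ∀ v, v = x := fun v => by
      have := hΓ (fun v => if v = x then 1 else 0) (fun e => by simp [h e]) v x
      by_contra h2
      simp [h2] at this
    rw [Finset.sum_eq_zero (fun v _ => by rw [h1 v, hx])] at hsum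
    omega
  obtain ⟨e₁, he₁⟩ := hex
  have hn1 : n e₁ = 1 := by
    by_cases h1 : Γ.src e₁ = x <;> by_cases h2 : Γ.tgt e₁ = x <;> simp_all
  have h1 : n e₁ + ∑ e ∈ Finset.univ.erase e₁, n e = ∑ e, n e :=
    Finset.add_sum_erase _ _ (Finset.mem_univ e₁)
  have h2 := hK x
  have h3 : ∑ e ∈ Finset.univ.erase e₁, n e = 1 := by omega
  obtain ⟨e₂, he₂, hne₂⟩ := Finset.exists_ne_zero_of_sum_ne_zero
    (s := Finset.univ.erase e₁) (f := n) (by omega)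
  have h4 := Finset.add_sum_erase _ n he₂
  have h5 : ∑ e ∈ (Finset.univ.erase e₁).erase e₂, n e = 0 := by omega
  have hn2 : n e₂ = 1 := by omega
  rw [Finset.sum_eq_zero_iff] at h5
  have h6 : ∀ e, e ≠ e₁ → e ≠ e₂ → Γ.src e ≠ x ∧ Γ.tgt e ≠ x := fun e h h' => by
    have := h5 e (by simp [h, h'])
    simp only [hn] at this
    constructor <;> intro h7 <;> simp [h7] at this
  have hj : ∀ e, n e = 1 → ∃ a : {v : V // v ≠ x}, Γ.Joins e a x := fun e he => by
    by_cases h1 : Γ.src e = x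
    · refine ⟨⟨Γ.tgt e, fun h2 => ?_⟩, Or.inr ⟨h1, rfl⟩⟩
      simp [hn, h1, h2] at he
    · refine ⟨⟨Γ.src e, h1⟩, Or.inl ⟨rfl, ?_⟩⟩
      by_contra h2
      simp [hn, h1, h2] at he
  obtain ⟨a, ha⟩ := hj e₁ hn1
  obtain ⟨b, hb⟩ := hj e₂ hn2
  exact ⟨a, b, e₁, e₂, (Finset.ne_of_mem_erase he₂).symm, ha, hb.symm,
    fun e h h' => (h6 e h h').1, fun e h h' => (h6 e h h').2⟩

/-- The lower bound for the invariant of the network. -/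
theorem network_bound {V E : Type*} {Γ : LengthGraph V E} [Fintype V] [Fintype E] (hΓ : Γ.Conn)
    {r : V → V → ℝ} (hr : Γ.IsResistance r) {q K : V → ℕ}
    (hK : ∀ v, Γ.deg v + 2 * q v = K v + 2) (hsum : ∑ v, K v = 4) (y : V) :
    (1 / 4 + 183 / 3328) * ∑ e, Γ.len e ≤ (∑ v, ∑ w, (K v : ℝ) * K w * r v w) / 12 -
      13 / 12 * (∑ e, r (Γ.src e) (Γ.tgt e) / Γ.len e * (r (Γ.src e) y + r (Γ.tgt e) y) -
        2 * ∑ v, r v y) +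
      13 / 36 * ∑ e, Γ.len e * (1 - r (Γ.src e) (Γ.tgt e) / Γ.len e) ^ 2 := by
  induction hn : Fintype.card V using Nat.strong_induction_on generalizing V E with
  | _ n ih =>
  by_cases hpos : ∀ v, 1 ≤ K v
  · exact network_bound_of_pos hr hΓ hK hpos hsum y
  · classical
    push Not at hpos
    obtain ⟨x, hx⟩ := hpos
    have hx0 : K x = 0 := by omega
    obtain ⟨a, b, e₁, e₂, hs⟩ := exists_isSeries hΓ hK hsum hx0
    have h := ih (Fintype.card {v : V // v ≠ x})
      (hn ▸ Fintype.card_subtype_lt (x := x) (by simp)) (hs.contract_conn hΓ)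
      (hs.contract_isResistance hr) (q := fun v => q v) (K := fun v => K v)
      (fun v => by rw [hs.contract_deg]; exact hK v)
      (by
        have := IsSeries.sum_subtype_ne (x := x) K
        rw [hx0, zero_add] at this
        exact this.trans hsum) b rfl
    have hl := hs.sum_symm (fun _ _ l => l) (fun _ _ _ => rfl)
    -- The pole y may be the erased vertex x; since κ does not depend on the pole, it is moved to b.
    rw [hr.kappa_eq y b, hs.invariant hr (K := fun v => (K v : ℝ)) (by simp [hx0])]
    have hl' : ∑ e, (Γ.contract b e₁ e₂).len e = ∑ e, Γ.len e := by linarith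
    rw [hl'] at h
    exact h

end LengthGraph
-- The geometric realization: coordinates, compactness, connectedness
namespace LengthGraph

variable {V E : Type*} (Γ : LengthGraph V E)

lemma continuous_mk : Continuous (Quot.mk Γ.Glue : Γ.Pieces → Γ.Point) := continuous_coinduced_rng

lemma continuous_pt (e : E) : Continuous (Γ.pt e) := by
  -- The topology of `Pieces` is built from the discrete topology on V, which has to be supplied
  -- locally.
  let V_top : TopologicalSpace V := ⊥
  have h : Continuous (fun t : ℝ =>
      (Sum.inr ⟨e, Set.projIcc 0 (Γ.len e) (Γ.len_pos e).le t⟩ : Γ.Pieces)) :=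
    continuous_inr.comp (continuous_sigmaMk.comp continuous_projIcc)
  exact Γ.continuous_mk.comp h

lemma pt_zero (e : E) : Γ.pt e 0 = Γ.vertex (Γ.src e) := by
  unfold pt vertex
  rw [Set.projIcc_left]
  exact Quot.sound (Glue.src e)

lemma pt_len (e : E) : Γ.pt e (Γ.len e) = Γ.vertex (Γ.tgt e) := by
  unfold pt vertex
  rw [Set.projIcc_right]
  exact Quot.sound (Glue.tgt e)

lemma pt_of_mem {e : E} {t : ℝ} (ht : t ∈ Icc 0 (Γ.len e)) :
    Γ.pt e t = Quot.mk _ (Sum.inr ⟨e, ⟨t, ht⟩⟩) := by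
  unfold pt; rw [Set.projIcc_of_mem _ ht]

lemma exists_rep (p : Γ.Point) :
    (∃ v, p = Γ.vertex v) ∨ ∃ e, ∃ t ∈ Ioo 0 (Γ.len e), p = Γ.pt e t := by
  induction p using Quot.ind with
  | mk p =>
  rcases p with v | ⟨e, t⟩
  · exact Or.inl ⟨v, rfl⟩
  · have h : (Quot.mk _ (Sum.inr ⟨e, t⟩) : Γ.Point) = Γ.pt e t := (Γ.pt_of_mem t.2).symm
    rw [h]
    rcases eq_or_lt_of_le t.2.1 with h0 | h0
    · rw [← h0, Γ.pt_zero]; exact Or.inl ⟨_, rfl⟩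
    rcases eq_or_lt_of_le t.2.2 with h1 | h1
    · rw [h1, Γ.pt_len]; exact Or.inl ⟨_, rfl⟩
    exact Or.inr ⟨e, t, ⟨h0, h1⟩, rfl⟩

open Classical in
/-- The unique representation of a point as a vertex or as an interior point of an edge. -/
noncomputable def rep : Γ.Point → V ⊕ (E × ℝ) :=
  Quot.lift (Sum.elim Sum.inl fun p => if (p.2 : ℝ) = 0 then Sum.inl (Γ.src p.1) else
    if (p.2 : ℝ) = Γ.len p.1 then Sum.inl (Γ.tgt p.1) else Sum.inr (p.1, p.2)) (by
    rintro _ _ (e | e)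
    · simp
    · simp [(Γ.len_pos e).ne'])

lemma rep_vertex (v : V) : Γ.rep (Γ.vertex v) = Sum.inl v := rfl

lemma rep_pt {e : E} {t : ℝ} (ht : t ∈ Ioo 0 (Γ.len e)) : Γ.rep (Γ.pt e t) = Sum.inr (e, t) := by
  rw [Γ.pt_of_mem (Ioo_subset_Icc_self ht)]
  simp [rep, ht.1.ne', ht.2.ne]

lemma vertex_injective : Function.Injective Γ.vertex := fun v w h => by
  have := congrArg Γ.rep h
  simpa [rep_vertex] using this

lemma pt_ne_vertex {e : E} {t : ℝ} (ht : t ∈ Ioo 0 (Γ.len e)) (v : V) :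
    Γ.pt e t ≠ Γ.vertex v := fun h => by
  have := congrArg Γ.rep h
  simp [rep_vertex, Γ.rep_pt ht] at this

lemma mem_Icc_cases {e : E} {t : ℝ} (ht : t ∈ Icc 0 (Γ.len e)) :
    t = 0 ∨ t = Γ.len e ∨ t ∈ Ioo 0 (Γ.len e) := by
  rcases eq_or_lt_of_le ht.1 with h0 | h0
  · exact Or.inl h0.symm
  rcases eq_or_lt_of_le ht.2 with h1 | h1
  · exact Or.inr (Or.inl h1)
  exact Or.inr (Or.inr ⟨h0, h1⟩)

lemma pt_eq_pt {e e' : E} {t t' : ℝ} (ht : t ∈ Ioo 0 (Γ.len e)) (ht' : t' ∈ Icc 0 (Γ.len e')) :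
    Γ.pt e' t' = Γ.pt e t ↔ e' = e ∧ t' = t := by
  constructor
  · intro h
    rcases Γ.mem_Icc_cases ht' with rfl | rfl | h'
    · rw [Γ.pt_zero] at h; exact absurd h.symm (Γ.pt_ne_vertex ht _)
    · rw [Γ.pt_len] at h; exact absurd h.symm (Γ.pt_ne_vertex ht _)
    · have := congrArg Γ.rep h
      rw [Γ.rep_pt ht, Γ.rep_pt h'] at this
      simpa using this
  · rintro ⟨rfl, rfl⟩; rfl

lemma pt_eq_vertex {e : E} {t : ℝ} (ht : t ∈ Icc 0 (Γ.len e)) (v : V) :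
    Γ.pt e t = Γ.vertex v ↔ (t = 0 ∧ Γ.src e = v) ∨ (t = Γ.len e ∧ Γ.tgt e = v) := by
  constructor
  · intro h
    rcases Γ.mem_Icc_cases ht with rfl | rfl | h'
    · rw [Γ.pt_zero] at h; exact Or.inl ⟨rfl, Γ.vertex_injective h⟩
    · rw [Γ.pt_len] at h; exact Or.inr ⟨rfl, Γ.vertex_injective h⟩
    · exact absurd h (Γ.pt_ne_vertex h' v)
  · rintro (⟨rfl, rfl⟩ | ⟨rfl, rfl⟩)
    · exact Γ.pt_zero e
    · exact Γ.pt_len e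

/-- The function on the graph with given values at the vertices and along the edges. -/
noncomputable def glueFun (u : V → ℝ) (φ : ∀ e, Icc (0 : ℝ) (Γ.len e) → ℝ)
    (h0 : ∀ e, φ e ⟨0, left_mem_Icc.2 (Γ.len_pos e).le⟩ = u (Γ.src e))
    (h1 : ∀ e, φ e ⟨Γ.len e, right_mem_Icc.2 (Γ.len_pos e).le⟩ = u (Γ.tgt e)) : Γ.Point → ℝ :=
  Quot.lift (Sum.elim u fun p => φ p.1 p.2) (by
    rintro _ _ (e | e)
    · exact h0 e
    · exact h1 e)

lemma glueFun_pt (u φ h0 h1) {e : E} {t : ℝ} (ht : t ∈ Icc 0 (Γ.len e)) :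
    Γ.glueFun u φ h0 h1 (Γ.pt e t) = φ e ⟨t, ht⟩ := by
  rw [Γ.pt_of_mem ht]; rfl

lemma continuous_glueFun (u φ h0 h1) (h : ∀ e, Continuous (φ e)) :
    Continuous (Γ.glueFun u φ h0 h1) := by
  let V_top : TopologicalSpace V := ⊥
  have V_disc : DiscreteTopology V := ⟨rfl⟩
  refine continuous_quot_lift _ ?_
  exact Continuous.sumElim continuous_of_discreteTopology (continuous_sigma h)

instance [Finite V] [Finite E] : CompactSpace Γ.Point := by
  let V_top : TopologicalSpace V := ⊥
  have : CompactSpace Γ.Pieces :=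
    inferInstanceAs (CompactSpace (V ⊕ (Σ e : E, Icc (0 : ℝ) (Γ.len e))))
  exact inferInstanceAs (CompactSpace (Quot Γ.Glue))

variable {Γ}

lemma conn_of_connectedSpace (h : ConnectedSpace Γ.Point) : Γ.Conn := by
  classical
  intro f hf v w
  let V_top : TopologicalSpace V := ⊥
  have V_disc : DiscreteTopology V := ⟨rfl⟩
  let F : Γ.Point → Bool := Quot.lift (Sum.elim (fun u => decide (f u = f w))
    fun p => decide (f (Γ.src p.1) = f w)) (by
      rintro _ _ (e | e)
      · rfl
      · simp [hf e])
  have hF : Continuous F := by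
    refine continuous_quot_lift _ ?_
    exact Continuous.sumElim continuous_of_discreteTopology
      (continuous_sigma fun e => continuous_const (y := decide (f (Γ.src e) = f w)))
  have h1 : F (Γ.vertex v) = F (Γ.vertex w) :=
    PreconnectedSpace.constant (α := Γ.Point) h.toPreconnectedSpace hF
      (x := Γ.vertex v) (y := Γ.vertex w)
  have h2 : decide (f v = f w) = decide (f w = f w) := h1
  simpa using h2

/-- A clopen set contains each edge entirely or misses it, so its indicator on vertices is constant
along edges. -/
lemma connectedSpace_of_conn [Nonempty V] (h : Γ.Conn) : ConnectedSpace Γ.Point := by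
  classical
  have : Nonempty Γ.Point := ⟨Γ.vertex (Classical.arbitrary V)⟩
  have hp : PreconnectedSpace Γ.Point := by
    rw [preconnectedSpace_iff_clopen]
    intro s hs
    have hedge : ∀ e, ∀ t ∈ Icc 0 (Γ.len e), ∀ t' ∈ Icc 0 (Γ.len e), Γ.pt e t ∈ s → Γ.pt e t' ∈ s := by
      intro e t _ t' _ h
      have h2 : IsClopen (Γ.pt e ⁻¹' s) := hs.preimage (Γ.continuous_pt e)
      rcases isClopen_iff.1 h2 with h3 | h3
      · have : t ∈ Γ.pt e ⁻¹' s := h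
        rw [h3] at this; exact this.elim
      · have : t' ∈ Γ.pt e ⁻¹' s := by rw [h3]; trivial
        exact this
    have hv := h (fun v => if Γ.vertex v ∈ s then 1 else 0) (fun e => by
      have l := left_mem_Icc.2 (Γ.len_pos e).le
      have r := right_mem_Icc.2 (Γ.len_pos e).le
      have h1 := hedge e _ l _ r
      have h2 := hedge e _ r _ l
      rw [pt_zero, pt_len] at h1 h2
      by_cases h3 : Γ.vertex (Γ.src e) ∈ s
      · simp [h3, h1 h3]
      · have h4 : Γ.vertex (Γ.tgt e) ∉ s := fun h4 => h3 (h2 h4)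
        simp [h3, h4])
    have hv' : ∀ v w, Γ.vertex v ∈ s → Γ.vertex w ∈ s := fun v w hvs => by
      have := hv v w
      by_contra h2
      simp [hvs, h2] at this
    have key : ∀ v, ∀ p, (p ∈ s ↔ Γ.vertex v ∈ s) := by
      intro v p
      rcases Γ.exists_rep p with ⟨w, rfl⟩ | ⟨e, t, ht, rfl⟩
      · exact ⟨hv' _ _, hv' _ _⟩
      · have l := left_mem_Icc.2 (Γ.len_pos e).le
        have h1 := hedge e _ l _ (Ioo_subset_Icc_self ht)
        have h2 := hedge e _ (Ioo_subset_Icc_self ht) _ l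
        rw [pt_zero] at h1 h2
        exact ⟨fun h => hv' _ _ (h2 h), fun h => h1 (hv' _ _ h)⟩
    by_cases h5 : Γ.vertex (Classical.arbitrary V) ∈ s
    · right; exact eq_univ_of_forall fun p => (key _ p).2 h5
    · left; exact eq_empty_of_forall_notMem fun p hp => h5 ((key _ p).1 hp)
  exact { toPreconnectedSpace := hp, toNonempty := this }

end LengthGraph

/-! ### Rays, slopes and uniqueness of the voltage -/

/-- A locally affine function on an open interval, continuous up to the left end, is affine. -/
lemma affine_of_locally_affine {ψ : ℝ → ℝ} {ε : ℝ} (hε : 0 < ε) (hc : Continuous ψ)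
    (h : ∀ s ∈ Ioo 0 ε, ∃ m, ∀ᶠ s' in 𝓝 s, ψ s' = ψ s + m * (s' - s)) :
    ∃ m, ∀ s ∈ Ico 0 ε, ψ s = ψ 0 + m * s := by
  have hd : ∀ s m, (∀ᶠ s' in 𝓝 s, ψ s' = ψ s + m * (s' - s)) → HasDerivAt ψ m s := by
    intro s m hm
    have h1 : HasDerivAt (fun s' => ψ s + m * (s' - s)) m s := by
      simpa using (((hasDerivAt_id s).sub_const s).const_mul m).const_add (ψ s)
    exact h1.congr_of_eventuallyEq hm
  -- The derivative is locally constant, hence equal to some m on the interval; then ψ - m s is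
  -- constant there, and up to the closure by continuity.
  have hd2 : ∀ s ∈ Ioo 0 ε, HasDerivAt (deriv ψ) 0 s := by
    intro s hs
    obtain ⟨m, hm⟩ := h s hs
    have h1 : deriv ψ =ᶠ[𝓝 s] fun _ => m := by
      filter_upwards [eventually_eventually_nhds.2 hm, hm] with s' hs' hs''
      refine (hd s' m ?_).deriv
      filter_upwards [hs'] with s'' h3
      rw [h3, hs'']; ring
    exact (hasDerivAt_const s m).congr_of_eventuallyEq h1
  obtain ⟨m, hm⟩ := isOpen_Ioo.exists_is_const_of_deriv_eq_zero isPreconnected_Ioo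
    (f := deriv ψ) (s := Ioo 0 ε) (fun s hs => (hd2 s hs).differentiableAt.differentiableWithinAt)
    (fun s hs => (hd2 s hs).deriv)
  have hψ : ∀ s ∈ Ioo 0 ε, HasDerivAt ψ m s := fun s hs => by
    obtain ⟨m', hm'⟩ := h s hs
    have := hd s m' hm'
    rwa [← this.deriv, hm s hs] at this
  have hg : ∀ s ∈ Ioo 0 ε, HasDerivAt (fun s => ψ s - m * s) 0 s := fun s hs => by
    simpa using (hψ s hs).fun_sub ((hasDerivAt_id s).const_mul m)
  obtain ⟨c, hc'⟩ := isOpen_Ioo.exists_is_const_of_deriv_eq_zero isPreconnected_Ioo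
    (f := fun s => ψ s - m * s) (s := Ioo 0 ε)
    (fun s hs => (hg s hs).differentiableAt.differentiableWithinAt)
    (fun s hs => (hg s hs).deriv)
  have hcl : ∀ s ∈ closure (Ioo 0 ε), ψ s - m * s = c := fun s hs =>
    closure_minimal (t := {s | ψ s - m * s = c}) hc' (isClosed_eq (by fun_prop) (by fun_prop)) hs
  rw [closure_Ioo hε.ne] at hcl
  have h0 := hcl 0 ⟨le_rfl, hε.le⟩
  refine ⟨m, fun s hs => ?_⟩
  have h1 := hcl s ⟨hs.1, hs.2.le⟩
  linarith

namespace LengthGraph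

variable {V E : Type*} {Γ : LengthGraph V E}

lemma fiber_finite (p : Γ.Point) (e : E) : {t | t ∈ Icc 0 (Γ.len e) ∧ Γ.pt e t = p}.Finite := by
  rcases Γ.exists_rep p with ⟨v, rfl⟩ | ⟨e', t', ht', rfl⟩
  · refine (Set.toFinite {0, Γ.len e}).subset ?_
    rintro t ⟨ht, h⟩
    rcases (Γ.pt_eq_vertex ht v).1 h with h | h <;> simp [h.1]
  · refine (Set.toFinite {t'}).subset ?_
    rintro t ⟨ht, h⟩
    exact ((Γ.pt_eq_pt ht' ht).1 h).2

lemma pos_mem_Icc {p : Γ.Point} {d : Direction E} (hd : d ∈ Γ.directions p) :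
    d.pos ∈ Icc 0 (Γ.len d.edge) := by
  have := hd.2
  split_ifs at this
  · exact Ico_subset_Icc_self this
  · exact Ioc_subset_Icc_self this

lemma directions_finite [Finite E] (p : Γ.Point) : (Γ.directions p).Finite := by
  have h : Γ.directions p ⊆ ⋃ e : E, ⋃ b : Bool,
      (fun t => (⟨e, t, b⟩ : Direction E)) '' {t | t ∈ Icc 0 (Γ.len e) ∧ Γ.pt e t = p} := by
    intro d hd
    simp only [mem_iUnion]
    exact ⟨d.edge, d.forward, d.pos, ⟨pos_mem_Icc hd, hd.1⟩, rfl⟩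
  exact (Set.finite_iUnion fun e => Set.finite_iUnion fun b => (fiber_finite p e).image _).subset h

lemma ray_zero {p : Γ.Point} {d : Direction E} (hd : d ∈ Γ.directions p) : Γ.ray d 0 = p := by
  unfold ray; simp [hd.1]

lemma continuous_ray (d : Direction E) : Continuous (Γ.ray d) := by
  unfold ray
  refine (Γ.continuous_pt d.edge).comp ?_
  split_ifs <;> fun_prop

/-- `f` is affine with slope `m` at the beginning of the ray `d`. -/
def RayAffine (Γ : LengthGraph V E) (f : Γ.Point → ℝ) (d : Direction E) (m : ℝ) : Prop :=
  ∃ ε > 0, ∀ s ∈ Ico 0 ε, f (Γ.ray d s) = f (Γ.ray d 0) + m * s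

lemma RayAffine.slope_eq {f : Γ.Point → ℝ} {d : Direction E} {m : ℝ} (h : Γ.RayAffine f d m) :
    Γ.slope f d = m := by
  obtain ⟨ε, hε, h⟩ := h
  have h1 : HasDerivWithinAt (fun s => f (Γ.ray d 0) + m * s) m (Ici 0) 0 := by
    simpa using (((hasDerivWithinAt_id (0 : ℝ) (Ici 0)).const_mul m).const_add (f (Γ.ray d 0)))
  have h2 : (fun s => f (Γ.ray d s)) =ᶠ[𝓝[≥] 0] fun s => f (Γ.ray d 0) + m * s := by
    filter_upwards [Ico_mem_nhdsGE hε] with s hs using h s hs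
  exact (h1.congr_of_eventuallyEq h2 (by simp)).derivWithin
    (uniqueDiffOn_Ici (0 : ℝ) 0 self_mem_Ici)

lemma RayAffine.sub {f g : Γ.Point → ℝ} {d : Direction E} {m n : ℝ} (hf : Γ.RayAffine f d m)
    (hg : Γ.RayAffine g d n) (c : ℝ) : Γ.RayAffine (fun p => f p - g p - c) d (m - n) := by
  obtain ⟨ε, hε, hf⟩ := hf
  obtain ⟨δ, hδ, hg⟩ := hg
  refine ⟨min ε δ, lt_min hε hδ, fun s hs => ?_⟩
  simp only
  rw [hf s ⟨hs.1, hs.2.trans_le (min_le_left _ _)⟩, hg s ⟨hs.1, hs.2.trans_le (min_le_right _ _)⟩]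
  ring

/-- Only finitely many parameters of the edge map into S, so a punctured neighbourhood of the
starting parameter avoids them. The starting point itself may lie in S; there continuity suffices.
-/
lemma rayAffine_of_affineNear [Finite E] {f : Γ.Point → ℝ} (hf : Continuous f) {S : Set Γ.Point}
    (hS : S.Finite)
    (h : ∀ e : E, ∀ t ∈ Ioo 0 (Γ.len e), Γ.pt e t ∉ S → Γ.AffineNear f e t)
    {p : Γ.Point} {d : Direction E} (hd : d ∈ Γ.directions p) : ∃ m, Γ.RayAffine f d m := by
  have hB : {t | t ∈ Icc 0 (Γ.len d.edge) ∧ Γ.pt d.edge t ∈ S}.Finite := by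
    refine (hS.biUnion fun p _ => fiber_finite p d.edge).subset ?_
    rintro t ⟨ht, h⟩
    exact mem_biUnion h ⟨ht, rfl⟩
  have hB2 : (insert d.pos {t | t ∈ Icc 0 (Γ.len d.edge) ∧ Γ.pt d.edge t ∈ S} \ {d.pos})ᶜ ∈
      𝓝 d.pos := ((hB.insert _).sdiff).isClosed.isOpen_compl.mem_nhds (by simp)
  rw [Metric.mem_nhds_iff] at hB2
  obtain ⟨δ, hδ, hB3⟩ := hB2
  have hgood : ∀ t ∈ Ioo 0 (Γ.len d.edge), t ≠ d.pos → |t - d.pos| < δ →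
      Γ.AffineNear f d.edge t := by
    intro t ht hne hlt
    refine h d.edge t ht fun hmem => ?_
    have := hB3 (show t ∈ Metric.ball d.pos δ by rwa [Metric.mem_ball, Real.dist_eq])
    exact this ⟨Or.inr ⟨Ioo_subset_Icc_self ht, hmem⟩, hne⟩
  have hpos := hd.2
  obtain ⟨e, t, b⟩ := d
  simp only at hgood hpos
  cases b
  · simp only [Bool.false_eq_true, if_false] at hpos
    obtain ⟨m, hm⟩ := affine_of_locally_affine (ψ := fun s => f (Γ.ray ⟨e, t, false⟩ s))
      (ε := min δ t) (lt_min hδ hpos.1) (hf.comp (continuous_ray _)) (by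
        intro s hs
        have h1 : s < δ := hs.2.trans_le (min_le_left _ _)
        have h2 : s < t := hs.2.trans_le (min_le_right _ _)
        obtain ⟨m, hm⟩ := hgood (t - s) ⟨by linarith, by linarith [hs.1, hpos.2]⟩
          (by linarith [hs.1]) (by rw [abs_lt]; constructor <;> linarith [hs.1])
        refine ⟨-m, ?_⟩
        have h3 : Tendsto (fun s' => t - s') (𝓝 s) (𝓝 (t - s)) :=
          (Continuous.tendsto (by fun_prop) s)
        filter_upwards [h3.eventually hm] with s' hs'
        simp only [ray, Bool.false_eq_true, if_false]
        rw [hs']; ring)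
    exact ⟨m, min δ t, lt_min hδ hpos.1, hm⟩
  · simp only [if_true] at hpos
    have hpos' : 0 < Γ.len e - t := by linarith [hpos.2]
    obtain ⟨m, hm⟩ := affine_of_locally_affine (ψ := fun s => f (Γ.ray ⟨e, t, true⟩ s))
      (ε := min δ (Γ.len e - t)) (lt_min hδ hpos') (hf.comp (continuous_ray _)) (by
        intro s hs
        have h1 : s < δ := hs.2.trans_le (min_le_left _ _)
        have h2 : s < Γ.len e - t := hs.2.trans_le (min_le_right _ _)
        obtain ⟨m, hm⟩ := hgood (t + s) ⟨by linarith [hs.1, hpos.1], by linarith⟩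
          (by linarith [hs.1]) (by rw [abs_lt]; constructor <;> linarith [hs.1])
        refine ⟨m, ?_⟩
        have h3 : Tendsto (fun s' => t + s') (𝓝 s) (𝓝 (t + s)) :=
          (Continuous.tendsto (by fun_prop) s)
        filter_upwards [h3.eventually hm] with s' hs'
        simp only [ray, if_true]
        rw [hs']; ring)
    exact ⟨m, min δ (Γ.len e - t), lt_min hδ hpos', hm⟩

lemma IsVoltage.rayAffine [Finite E] {z y : Γ.Point} {f : Γ.Point → ℝ} (hf : Γ.IsVoltage z y f)
    {p : Γ.Point} {d : Direction E} (hd : d ∈ Γ.directions p) : Γ.RayAffine f d (Γ.slope f d) := by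
  obtain ⟨m, hm⟩ := rayAffine_of_affineNear hf.continuous (Set.toFinite {y, z})
    (fun e t ht hS => hf.affine e t ht (fun h => hS (by simp [h])) (fun h => hS (by simp [h]))) hd
  rwa [hm.slope_eq]

/-- A set of points of an edge which is closed and contains the beginnings of all rays starting in it
contains the whole edge as soon as it is not empty. -/
lemma edge_subset {S : Set Γ.Point} (hS : IsClosed S)
    (h : ∀ p ∈ S, ∀ d ∈ Γ.directions p, ∃ ε > 0, ∀ s ∈ Ico 0 ε, Γ.ray d s ∈ S) {e : E} {t : ℝ}
    (ht : t ∈ Icc 0 (Γ.len e)) (hp : Γ.pt e t ∈ S) : ∀ u ∈ Icc 0 (Γ.len e), Γ.pt e u ∈ S := by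
  -- Continuous induction along the edge: forward to its end, then backward over all of it.
  have hfwd : ∀ t ∈ Icc 0 (Γ.len e), Γ.pt e t ∈ S → ∀ u ∈ Icc t (Γ.len e), Γ.pt e u ∈ S := by
    intro t ht hp
    refine IsClosed.Icc_subset_of_forall_mem_nhdsWithin (s := {u | Γ.pt e u ∈ S})
      ((hS.preimage (Γ.continuous_pt e)).inter isClosed_Icc) hp ?_
    rintro x ⟨hx, hxt, hxL⟩
    obtain ⟨ε, hε, h1⟩ := h _ hx ⟨e, x, true⟩ ⟨rfl, by simpa using ⟨ht.1.trans hxt, hxL⟩⟩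
    filter_upwards [Ioo_mem_nhdsGT (show x < x + ε by linarith)] with u hu
    have := h1 (u - x) ⟨by linarith [hu.1], by linarith [hu.2]⟩
    simpa [ray] using this
  have hbwd : ∀ t ∈ Icc 0 (Γ.len e), Γ.pt e (Γ.len e - t) ∈ S → ∀ u ∈ Icc t (Γ.len e),
      Γ.pt e (Γ.len e - u) ∈ S := by
    intro t ht hp
    refine IsClosed.Icc_subset_of_forall_mem_nhdsWithin (s := {u | Γ.pt e (Γ.len e - u) ∈ S})
      ((hS.preimage ((Γ.continuous_pt e).comp (by fun_prop))).inter isClosed_Icc) hp ?_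
    rintro x ⟨hx, hxt, hxL⟩
    obtain ⟨ε, hε, h1⟩ := h _ hx ⟨e, Γ.len e - x, false⟩
      ⟨rfl, by simpa using ⟨hxL, ht.1.trans hxt⟩⟩
    filter_upwards [Ioo_mem_nhdsGT (show x < x + ε by linarith)] with u hu
    have := h1 (u - x) ⟨by linarith [hu.1], by linarith [hu.2]⟩
    simp only [ray, Bool.false_eq_true, if_false] at this
    show Γ.pt e (Γ.len e - u) ∈ S
    convert this using 2; ring
  intro u hu
  have h1 := hfwd t ht hp (Γ.len e) ⟨ht.2, le_rfl⟩
  have h2 := hbwd 0 ⟨le_rfl, (Γ.len_pos e).le⟩ (by simpa using h1) (Γ.len e - u)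
    ⟨by linarith [hu.2], by linarith [hu.1]⟩
  simpa using h2

/-- Maximum principle. At a maximum of f - g all slopes are nonpositive, while Kirchhoff's law makes
their sum zero; hence they vanish, and f - g keeps its maximal value along the beginning of every
ray. The closed set of maxima is therefore everything, and the common reference value at z makes the
difference zero. -/
theorem IsVoltage.unique [Finite V] [Finite E] (hΓ : Γ.Conn) {z y : Γ.Point} {f g : Γ.Point → ℝ}
    (hf : Γ.IsVoltage z y f) (hg : Γ.IsVoltage z y g) : f = g := by
  have hcont : Continuous fun p => f p - g p := hf.continuous.sub hg.continuous
  obtain ⟨p₀, -, hp₀⟩ := isCompact_univ.exists_isMaxOn (⟨z, mem_univ z⟩ : (univ : Set Γ.Point).Nonempty)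
    hcont.continuousOn
  have hmax : ∀ p, f p - g p ≤ f p₀ - g p₀ := fun p => hp₀ (mem_univ p)
  set M := f p₀ - g p₀ with hM
  set S : Set Γ.Point := {p | f p - g p = M} with hSdef
  have hS : IsClosed S := isClosed_eq hcont continuous_const
  have hray : ∀ p ∈ S, ∀ d ∈ Γ.directions p, ∃ ε > 0, ∀ s ∈ Ico 0 ε, Γ.ray d s ∈ S := by
    intro p hp
    have hra : ∀ d ∈ Γ.directions p,
        Γ.RayAffine (fun p => f p - g p - 0) d (Γ.slope f d - Γ.slope g d) := fun d hd =>
      (hf.rayAffine hd).sub (hg.rayAffine hd) 0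
    have hle : ∀ d ∈ Γ.directions p, Γ.slope f d - Γ.slope g d ≤ 0 := by
      intro d hd
      obtain ⟨ε, hε, h⟩ := hra d hd
      have h1 := h (ε / 2) ⟨by linarith, by linarith⟩
      have h2 := hmax (Γ.ray d (ε / 2))
      rw [ray_zero hd] at h1
      have h3 : f p - g p = M := hp
      by_contra! h4
      have := mul_pos h4 (show 0 < ε / 2 by linarith)
      linarith
    have hsum : ∑ᶠ d ∈ Γ.directions p, (Γ.slope f d - Γ.slope g d) = 0 := by
      rw [finsum_mem_sub_distrib _ _ (directions_finite p)]
      have h1 := hf.kirchhoff p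
      have h2 := hg.kirchhoff p
      linarith
    have hzero : ∀ d ∈ Γ.directions p, Γ.slope f d - Γ.slope g d = 0 := by
      rw [finsum_mem_eq_finite_toFinset_sum _ (directions_finite p)] at hsum
      intro d hd
      exact (Finset.sum_eq_zero_iff_of_nonpos (fun d hd => hle d (by simpa using hd))).1 hsum d
        (by simpa using hd)
    intro d hd
    obtain ⟨ε, hε, h⟩ := hra d hd
    refine ⟨ε, hε, fun s hs => ?_⟩
    have h1 := h s hs
    rw [hzero d hd, ray_zero hd] at h1
    have h3 : f p - g p = M := hp
    show f _ - g _ = M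
    linarith
  have hl : ∀ e : E, (0 : ℝ) ∈ Icc 0 (Γ.len e) := fun e => left_mem_Icc.2 (Γ.len_pos e).le
  have hr : ∀ e : E, Γ.len e ∈ Icc 0 (Γ.len e) := fun e => right_mem_Icc.2 (Γ.len_pos e).le
  classical
  have hconst := hΓ (fun v => if Γ.vertex v ∈ S then (1 : ℝ) else 0) (fun e => by
    have h1 := fun h => edge_subset hS hray (hl e) h _ (hr e)
    have h2 := fun h => edge_subset hS hray (hr e) h _ (hl e)
    rw [pt_zero, pt_len] at h1 h2
    by_cases h3 : Γ.vertex (Γ.src e) ∈ S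
    · simp [h3, h1 h3]
    · have h4 : Γ.vertex (Γ.tgt e) ∉ S := fun h4 => h3 (h2 h4)
      simp [h3, h4])
  obtain ⟨v₀, hv₀⟩ : ∃ v, Γ.vertex v ∈ S := by
    have hp₀S : p₀ ∈ S := rfl
    rcases Γ.exists_rep p₀ with ⟨v, h⟩ | ⟨e, t, ht, h⟩
    · exact ⟨v, h ▸ hp₀S⟩
    · refine ⟨Γ.src e, ?_⟩
      rw [h] at hp₀S
      rw [← pt_zero]
      exact edge_subset hS hray (Ioo_subset_Icc_self ht) hp₀S _ (hl e)
  have hv : ∀ v, Γ.vertex v ∈ S := fun v => by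
    have := hconst v v₀
    by_contra h
    simp [h, hv₀] at this
  have hall : ∀ p, p ∈ S := by
    intro p
    rcases Γ.exists_rep p with ⟨v, rfl⟩ | ⟨e, t, ht, rfl⟩
    · exact hv v
    · exact edge_subset hS hray (hl e) (by rw [pt_zero]; exact hv _) _ (Ioo_subset_Icc_self ht)
  funext p
  have h1 : f p - g p = M := hall p
  have h2 : f z - g z = M := hall z
  rw [hf.reference, hg.reference] at h2
  linarith

end LengthGraph
-- The Green function of the metrized graph and existence of voltages
namespace LengthGraph

variable {V E : Type*} (Γ : LengthGraph V E)

section directions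
variable {Γ}

lemma directions_pt {e : E} {t : ℝ} (ht : t ∈ Ioo 0 (Γ.len e)) :
    Γ.directions (Γ.pt e t) = {⟨e, t, true⟩, ⟨e, t, false⟩} := by
  ext d
  constructor
  · intro hd
    obtain ⟨h1, h2⟩ := (Γ.pt_eq_pt ht (pos_mem_Icc hd)).1 hd.1
    obtain ⟨e', t', b⟩ := d
    simp only at h1 h2
    subst h1 h2
    cases b <;> simp
  · rintro (rfl | rfl)
    · exact ⟨rfl, by simpa using ⟨ht.1.le, ht.2⟩⟩
    · exact ⟨rfl, by simpa using ⟨ht.1, ht.2.le⟩⟩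

variable [Fintype E]

open Classical in
lemma directions_vertex (v : V) : Γ.directions (Γ.vertex v) =
    (((Finset.univ.filter fun e => Γ.src e = v).image fun e => (⟨e, 0, true⟩ : Direction E)) ∪
    ((Finset.univ.filter fun e => Γ.tgt e = v).image
      fun e => (⟨e, Γ.len e, false⟩ : Direction E)) : Finset (Direction E)) := by
  ext d
  simp only [Finset.coe_union, Finset.coe_image, Finset.coe_filter, Finset.mem_univ, true_and,
    mem_union, mem_image, mem_ofPred_eq]
  constructor
  · intro hd
    have h1 := (Γ.pt_eq_vertex (pos_mem_Icc hd) v).1 hd.1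
    have h2 := hd.2
    obtain ⟨e, t, b⟩ := d
    simp only at h1 h2
    have hL := Γ.len_pos e
    cases b
    · simp only [Bool.false_eq_true, if_false] at h2
      rcases h1 with ⟨rfl, h⟩ | ⟨rfl, h⟩
      · exact absurd h2.1 (lt_irrefl _)
      · exact Or.inr ⟨e, h, rfl⟩
    · simp only [if_true] at h2
      rcases h1 with ⟨rfl, h⟩ | ⟨rfl, h⟩
      · exact Or.inl ⟨e, h, rfl⟩
      · exact absurd h2.2 (lt_irrefl _)
  · rintro (⟨e, rfl, rfl⟩ | ⟨e, rfl, rfl⟩)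
    · exact ⟨Γ.pt_zero e, by simpa using Γ.len_pos e⟩
    · exact ⟨Γ.pt_len e, by simpa using Γ.len_pos e⟩

open Classical in
lemma sum_directions_vertex {M : Type*} [AddCommMonoid M] (v : V) (g : Direction E → M) :
    ∑ᶠ d ∈ Γ.directions (Γ.vertex v), g d =
      ∑ e, ((if Γ.src e = v then g ⟨e, 0, true⟩ else 0) +
        (if Γ.tgt e = v then g ⟨e, Γ.len e, false⟩ else 0)) := by
  rw [directions_vertex, finsum_mem_coe_finset, Finset.sum_union, Finset.sum_image, Finset.sum_image,
    Finset.sum_filter, Finset.sum_filter, Finset.sum_add_distrib]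
  · intro e _ e' _ h
    simpa using congrArg Direction.edge h
  · intro e _ e' _ h
    simpa using congrArg Direction.edge h
  · rw [Finset.disjoint_left]
    intro d h1 h2
    obtain ⟨e, -, rfl⟩ := Finset.mem_image.1 h1
    obtain ⟨e', -, h⟩ := Finset.mem_image.1 h2
    simpa using congrArg Direction.forward h

lemma valence_vertex (v : V) : Γ.valence (Γ.vertex v) = Γ.deg v := by
  classical
  have h := sum_directions_vertex v (fun _ : Direction E => (1 : ℕ)) (Γ := Γ)
  rw [finsum_mem_eq_finite_toFinset_sum _ (directions_finite _)] at h
  unfold valence deg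
  rw [← h, Set.ncard_eq_toFinset_card _ (directions_finite _)]
  simp

end directions

/-- The affine interpolation of a function of the vertices. -/
noncomputable def interp (u : V → ℝ) : Γ.Point → ℝ :=
  Γ.glueFun u (fun e s => (1 - s / Γ.len e) * u (Γ.src e) + s / Γ.len e * u (Γ.tgt e))
    (fun e => by simp) (fun e => by simp [div_self (Γ.len_pos e).ne'])

open Classical in
/-- The Green function with vanishing boundary values of the edge `e`, with pole `t`. -/
noncomputable def tentFun (e : E) (t : Icc (0 : ℝ) (Γ.len e)) : Γ.Point → ℝ :=
  Γ.glueFun (fun _ => 0) (fun e' s => if e' = e then min (s : ℝ) t - s * t / Γ.len e else 0)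
    (fun e' => by simp [t.2.1])
    (fun e' => by
      by_cases h : e' = e
      · subst h
        simp only [if_true, min_eq_right t.2.2, mul_div_cancel_left₀ _ (Γ.len_pos e').ne', sub_self]
      · simp [h])

/-- The Green function of the edge containing a point. -/
noncomputable def tent (y : Γ.Point) : Γ.Point → ℝ :=
  match Γ.rep y with
  | Sum.inl _ => fun _ => 0
  | Sum.inr (e, t) => Γ.tentFun e (Set.projIcc 0 (Γ.len e) (Γ.len_pos e).le t)

/-- The interpolation of the columns of a matrix. -/
noncomputable def pot (G : V → V → ℝ) (y : Γ.Point) : V → ℝ :=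
  match Γ.rep y with
  | Sum.inl w => fun v => G v w
  | Sum.inr (e, t) => fun v =>
      (1 - t / Γ.len e) * G v (Γ.src e) + t / Γ.len e * G v (Γ.tgt e)

/-- The Green function of the metrized graph with pole `y`. -/
noncomputable def kernel (G : V → V → ℝ) (y x : Γ.Point) : ℝ := Γ.interp (Γ.pot G y) x + Γ.tent y x

variable {Γ}

lemma interp_vertex (u : V → ℝ) (v : V) : Γ.interp u (Γ.vertex v) = u v := rfl

lemma interp_pt (u : V → ℝ) {e : E} {s : ℝ} (hs : s ∈ Icc 0 (Γ.len e)) : Γ.interp u (Γ.pt e s) =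
    (1 - s / Γ.len e) * u (Γ.src e) + s / Γ.len e * u (Γ.tgt e) := by
  unfold interp; rw [Γ.glueFun_pt _ _ _ _ hs]

lemma tent_vertex (w : V) (x : Γ.Point) : Γ.tent (Γ.vertex w) x = 0 := rfl

open Classical in
lemma tentFun_pt {e e' : E} (t : Icc 0 (Γ.len e)) {s : ℝ} (hs : s ∈ Icc 0 (Γ.len e')) :
    Γ.tentFun e t (Γ.pt e' s) = if e' = e then min s t - s * t / Γ.len e else 0 := by
  unfold tentFun; rw [Γ.glueFun_pt _ _ _ _ hs]

open Classical in
lemma tent_pt_pt {e e' : E} {s t : ℝ} (ht : t ∈ Icc 0 (Γ.len e)) (hs : s ∈ Icc 0 (Γ.len e')) :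
    Γ.tent (Γ.pt e t) (Γ.pt e' s) = if e' = e then min s t - s * t / Γ.len e else 0 := by
  rcases Γ.mem_Icc_cases ht with rfl | rfl | h
  · rw [pt_zero, tent_vertex]; simp [hs.1]
  · rw [pt_len, tent_vertex]
    by_cases h : e' = e
    · subst h
      simp only [if_true, min_eq_left hs.2, mul_div_cancel_right₀ _ (Γ.len_pos e').ne', sub_self]
    · simp [h]
  · unfold tent
    rw [Γ.rep_pt h]
    simp only
    rw [tentFun_pt _ hs, Set.projIcc_of_mem _ ht]

lemma tent_pt_vertex {e : E} {t : ℝ} (ht : t ∈ Icc 0 (Γ.len e)) (v : V) :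
    Γ.tent (Γ.pt e t) (Γ.vertex v) = 0 := by
  rcases Γ.mem_Icc_cases ht with rfl | rfl | h
  · rw [pt_zero, tent_vertex]
  · rw [pt_len, tent_vertex]
  · unfold tent
    rw [Γ.rep_pt h]
    rfl

lemma pot_vertex (G : V → V → ℝ) (w v : V) : Γ.pot G (Γ.vertex w) v = G v w := rfl

lemma pot_pt (G : V → V → ℝ) {e : E} {t : ℝ} (ht : t ∈ Icc 0 (Γ.len e)) (v : V) :
    Γ.pot G (Γ.pt e t) v = (1 - t / Γ.len e) * G v (Γ.src e) + t / Γ.len e * G v (Γ.tgt e) := by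
  rcases Γ.mem_Icc_cases ht with rfl | rfl | h
  · rw [pt_zero, pot_vertex]; simp
  · rw [pt_len, pot_vertex]; simp [div_self (Γ.len_pos e).ne']
  · unfold pot
    rw [Γ.rep_pt h]

lemma continuous_tent (y : Γ.Point) : Continuous (Γ.tent y) := by
  rcases Γ.exists_rep y with ⟨v, rfl⟩ | ⟨e, t, ht, rfl⟩
  · exact continuous_const
  · unfold tent
    rw [Γ.rep_pt ht]
    refine Γ.continuous_glueFun _ _ _ _ fun e' => ?_
    split_ifs <;> fun_prop

lemma continuous_interp (u : V → ℝ) : Continuous (Γ.interp u) :=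
  Γ.continuous_glueFun _ _ _ _ fun e' => by fun_prop

lemma continuous_kernel (G : V → V → ℝ) (y : Γ.Point) : Continuous (Γ.kernel G y) :=
  (continuous_interp _).add (continuous_tent y)

/-- The shape along the edges of a function with potentials `u` at the vertices and tents of height
`c`. -/
def HasProfile (Γ : LengthGraph V E) (f : Γ.Point → ℝ) (u : V → ℝ) (c t : E → ℝ) : Prop :=
  ∀ e, ∀ s ∈ Icc 0 (Γ.len e), f (Γ.pt e s) = (1 - s / Γ.len e) * u (Γ.src e) +
    s / Γ.len e * u (Γ.tgt e) + c e * (min s (t e) - s * t e / Γ.len e)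

lemma kernel_profile_vertex (G : V → V → ℝ) (w : V) :
    Γ.HasProfile (Γ.kernel G (Γ.vertex w)) (fun v => G v w) 0 0 := by
  intro e s hs
  unfold kernel
  rw [interp_pt _ hs, tent_vertex]
  simp [pot_vertex]

open Classical in
lemma kernel_profile_pt (G : V → V → ℝ) {e : E} {t : ℝ} (ht : t ∈ Icc 0 (Γ.len e)) :
    Γ.HasProfile (Γ.kernel G (Γ.pt e t))
      (fun v => (1 - t / Γ.len e) * G v (Γ.src e) + t / Γ.len e * G v (Γ.tgt e))
      (fun e' => if e' = e then 1 else 0) (fun _ => t) := by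
  intro e' s hs
  unfold kernel
  rw [interp_pt _ hs, tent_pt_pt ht hs, pot_pt _ ht, pot_pt _ ht]
  congr 1
  by_cases h : e' = e
  · subst h; simp
  · simp [h]

namespace HasProfile
variable {f : Γ.Point → ℝ} {u : V → ℝ} {c t : E → ℝ} (hf : Γ.HasProfile f u c t)
include hf

-- The condition is strict here and weak in `slope_backward`: at s = t both rays leave the peak of
-- the tent, and the slopes add up to -c e.
open Classical in
lemma slope_forward {e : E} {s : ℝ} (hs : s ∈ Ico 0 (Γ.len e)) :
    Γ.RayAffine f ⟨e, s, true⟩ ((u (Γ.tgt e) - u (Γ.src e)) / Γ.len e +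
      c e * ((if s < t e then 1 else 0) - t e / Γ.len e)) := by
  have hL := Γ.len_pos e
  refine ⟨if s < t e then min (Γ.len e - s) (t e - s) else Γ.len e - s, ?_, fun x hx => ?_⟩
  · split_ifs with h
    · exact lt_min (by linarith [hs.2]) (by linarith)
    · linarith [hs.2]
  · simp only [ray, if_true, add_zero]
    by_cases h : s < t e
    · rw [if_pos h] at hx
      have h1 := hx.2.trans_le (min_le_left _ _)
      have h2 := hx.2.trans_le (min_le_right _ _)
      rw [hf e _ ⟨by linarith [hs.1, hx.1], by linarith⟩, hf e _ ⟨hs.1, hs.2.le⟩, if_pos h,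
        min_eq_left (by linarith), min_eq_left h.le]
      field_simp; ring
    · rw [if_neg h] at hx
      rw [hf e _ ⟨by linarith [hs.1, hx.1], by linarith [hx.2]⟩, hf e _ ⟨hs.1, hs.2.le⟩, if_neg h,
        min_eq_right (by linarith [hx.1]), min_eq_right (by linarith)]
      field_simp; ring

open Classical in
lemma slope_backward {e : E} {s : ℝ} (hs : s ∈ Ioc 0 (Γ.len e)) :
    Γ.RayAffine f ⟨e, s, false⟩ ((u (Γ.src e) - u (Γ.tgt e)) / Γ.len e +
      c e * (t e / Γ.len e - (if s ≤ t e then 1 else 0))) := by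
  have hL := Γ.len_pos e
  refine ⟨if s ≤ t e then s else min s (s - t e), ?_, fun x hx => ?_⟩
  · split_ifs with h
    · exact hs.1
    · exact lt_min hs.1 (by linarith)
  · simp only [ray, Bool.false_eq_true, if_false, sub_zero]
    by_cases h : s ≤ t e
    · rw [if_pos h] at hx
      rw [hf e _ ⟨by linarith [hs.1, hx.2], by linarith [hs.2, hx.1]⟩, hf e _ ⟨hs.1.le, hs.2⟩,
        if_pos h, min_eq_left (by linarith [hx.1]), min_eq_left h]
      field_simp; ring
    · rw [if_neg h] at hx
      have h1 := hx.2.trans_le (min_le_left _ _)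
      have h2 := hx.2.trans_le (min_le_right _ _)
      rw [hf e _ ⟨by linarith [hs.1], by linarith [hs.2, hx.1]⟩, hf e _ ⟨hs.1.le, hs.2⟩,
        if_neg h, min_eq_right (by linarith), min_eq_right (by linarith)]
      field_simp; ring

lemma affineNear {e : E} {s : ℝ} (hs : s ∈ Ioo 0 (Γ.len e)) (h : c e = 0 ∨ s ≠ t e) :
    Γ.AffineNear f e s := by
  classical
  have hL := Γ.len_pos e
  refine ⟨(u (Γ.tgt e) - u (Γ.src e)) / Γ.len e +
      c e * ((if s < t e then 1 else 0) - t e / Γ.len e), ?_⟩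
  have h1 := Ioo_mem_nhds hs.1 hs.2
  rcases h with h | h
  · filter_upwards [h1] with x hx
    rw [hf e _ (Ioo_subset_Icc_self hx), hf e _ (Ioo_subset_Icc_self hs), h]
    field_simp; ring
  · rcases lt_or_gt_of_ne h with h2 | h2
    · filter_upwards [h1, Iio_mem_nhds h2] with x hx hx2
      rw [hf e _ (Ioo_subset_Icc_self hx), hf e _ (Ioo_subset_Icc_self hs), if_pos h2,
        min_eq_left h2.le, min_eq_left (le_of_lt hx2)]
      field_simp; ring
    · filter_upwards [h1, Ioi_mem_nhds h2] with x hx hx2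
      rw [hf e _ (Ioo_subset_Icc_self hx), hf e _ (Ioo_subset_Icc_self hs), if_neg h2.not_gt,
        min_eq_right h2.le, min_eq_right (le_of_lt hx2)]
      field_simp; ring

open Classical in
lemma sum_slope_pt {e : E} {s : ℝ} (hs : s ∈ Ioo 0 (Γ.len e)) :
    ∑ᶠ d ∈ Γ.directions (Γ.pt e s), Γ.slope f d = - c e * (if s = t e then 1 else 0) := by
  rw [directions_pt hs, finsum_mem_pair (by simp), (hf.slope_forward ⟨hs.1.le, hs.2⟩).slope_eq,
    (hf.slope_backward ⟨hs.1, hs.2.le⟩).slope_eq]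
  have hL := Γ.len_pos e
  rcases lt_trichotomy s (t e) with h | h | h
  · rw [if_pos h, if_pos h.le, if_neg h.ne]; ring
  · rw [if_neg (by linarith), if_pos h.le, if_pos h]; ring
  · rw [if_neg (by linarith), if_neg (by linarith), if_neg h.ne']; ring

open Classical in
lemma sum_slope_vertex [Fintype E] (v : V) :
    ∑ᶠ d ∈ Γ.directions (Γ.vertex v), Γ.slope f d =
      - Γ.energy (fun w => if w = v then 1 else 0) u +
      ∑ e, c e * ((if Γ.src e = v then (if 0 < t e then 1 else 0) - t e / Γ.len e else 0) +
        (if Γ.tgt e = v then t e / Γ.len e - (if Γ.len e ≤ t e then 1 else 0) else 0)) := by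
  rw [sum_directions_vertex]
  unfold energy
  rw [← Finset.sum_neg_distrib, ← Finset.sum_add_distrib]
  refine Finset.sum_congr rfl fun e _ => ?_
  have hL := Γ.len_pos e
  rw [(hf.slope_forward ⟨le_rfl, hL⟩).slope_eq, (hf.slope_backward ⟨hL, le_rfl⟩).slope_eq]
  by_cases h1 : Γ.src e = v <;> by_cases h2 : Γ.tgt e = v <;> simp only [h1, h2, if_true, if_false] <;>
    ring

end HasProfile

variable [Fintype V] [Fintype E] {G : V → V → ℝ}

omit [Fintype V] [Fintype E] in
lemma kernel_affineNear {y : Γ.Point} {e : E} {s : ℝ} (hs : s ∈ Ioo 0 (Γ.len e))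
    (h : Γ.pt e s ≠ y) : Γ.AffineNear (Γ.kernel G y) e s := by
  classical
  rcases Γ.exists_rep y with ⟨w, rfl⟩ | ⟨e', t, ht, rfl⟩
  · exact (kernel_profile_vertex G w).affineNear hs (Or.inl rfl)
  · refine (kernel_profile_pt G (Ioo_subset_Icc_self ht)).affineNear hs ?_
    by_cases he : e = e'
    · subst he
      right
      rintro rfl
      exact h rfl
    · left; simp [he]

-- The kernel has a unit source at y against a uniform sink of 1 / |V| at every vertex. For a pole
-- inside an edge, the slopes 1 - t/L and t/L of the tent at the ends cancel the vertex sources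
-- created by interpolating the columns of G.
open Classical in
lemma IsGreen.sum_slope_kernel (hG : Γ.IsGreen G) (y p : Γ.Point) :
    ∑ᶠ d ∈ Γ.directions p, Γ.slope (Γ.kernel G y) d =
      (if ∃ v, p = Γ.vertex v then 1 / (Fintype.card V : ℝ) else 0) - if p = y then 1 else 0 := by
  rcases Γ.exists_rep y with ⟨w, rfl⟩ | ⟨e, t, ht, rfl⟩
  · have hf := kernel_profile_vertex (Γ := Γ) G w
    rcases Γ.exists_rep p with ⟨v, rfl⟩ | ⟨e', s, hs, rfl⟩
    · rw [hf.sum_slope_vertex, hG.green]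
      have h : Γ.vertex v = Γ.vertex w ↔ w = v :=
        ⟨fun h => (Γ.vertex_injective h).symm, fun h => by rw [h]⟩
      simp [h]
    · rw [hf.sum_slope_pt hs]
      simp [Γ.pt_ne_vertex hs]
  · have hf := kernel_profile_pt G (Ioo_subset_Icc_self ht)
    rcases Γ.exists_rep p with ⟨v, rfl⟩ | ⟨e', s, hs, rfl⟩
    · rw [hf.sum_slope_vertex, energy_add_right, energy_mul_right, energy_mul_right, hG.green,
        hG.green]
      have h : Γ.vertex v ≠ Γ.pt e t := (Γ.pt_ne_vertex ht v).symm
      simp only [h, if_false, if_true, ite_mul, one_mul, zero_mul,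
        Finset.sum_ite_eq', Finset.mem_univ, ht.1, not_le.2 ht.2,
        Γ.vertex_injective.eq_iff, exists_eq']
      by_cases h1 : Γ.src e = v <;> by_cases h2 : Γ.tgt e = v <;> simp [h1, h2] <;> ring
    · rw [hf.sum_slope_pt hs]
      have h : Γ.pt e' s = Γ.pt e t ↔ e' = e ∧ s = t := Γ.pt_eq_pt ht (Ioo_subset_Icc_self hs)
      have h' : ¬ ∃ v, Γ.pt e' s = Γ.vertex v := fun ⟨v, hv⟩ => Γ.pt_ne_vertex hs v hv
      simp only [h, h', if_false]
      by_cases h1 : e' = e <;> by_cases h2 : s = t <;> simp [h1, h2]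

/-- The uniform sink does not depend on the pole and cancels in the difference. -/
theorem IsGreen.isVoltage (hG : Γ.IsGreen G) (z y : Γ.Point) : Γ.IsVoltage z y (fun x =>
    Γ.kernel G y x - Γ.kernel G z x - (Γ.kernel G y z - Γ.kernel G z z)) where
  continuous := ((continuous_kernel G y).sub (continuous_kernel G z)).sub continuous_const
  reference := sub_self _
  affine e t ht hy hz := by
    obtain ⟨m, hm⟩ := kernel_affineNear (G := G) ht hy
    obtain ⟨n, hn⟩ := kernel_affineNear (G := G) ht hz
    refine ⟨m - n, ?_⟩
    filter_upwards [hm, hn] with s h1 h2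
    rw [h1, h2]; ring
  kirchhoff p := by
    have hra : ∀ w : Γ.Point, ∀ d ∈ Γ.directions p,
        Γ.RayAffine (Γ.kernel G w) d (Γ.slope (Γ.kernel G w) d) := fun w d hd => by
      obtain ⟨m, hm⟩ := rayAffine_of_affineNear (continuous_kernel G w) (Set.toFinite {w})
        (fun e t ht hS => kernel_affineNear ht hS) hd
      rwa [hm.slope_eq]
    rw [finsum_mem_congr rfl fun d hd => ((hra y d hd).sub (hra z d hd) _).slope_eq,
      finsum_mem_sub_distrib _ _ (directions_finite p), hG.sum_slope_kernel, hG.sum_slope_kernel]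
    ring

theorem IsGreen.resistance_eq (hG : Γ.IsGreen G) (hΓ : Γ.Conn) (x y : Γ.Point) :
    Γ.resistance x y =
      Γ.kernel G x x - Γ.kernel G y x - (Γ.kernel G x y - Γ.kernel G y y) := by
  unfold resistance voltage
  have h := hG.isVoltage y x
  have h2 : Γ.IsVoltage y x (Classical.epsilon (Γ.IsVoltage y x)) := Classical.epsilon_spec ⟨_, h⟩
  rw [h2.unique hΓ h]

end LengthGraph
-- Functions quadratic along edges, and edge densities
namespace LengthGraph

variable {V E : Type*} {Γ : LengthGraph V E}

lemma kernel_comm {G : V → V → ℝ} (hG : ∀ v w, G v w = G w v) (x y : Γ.Point) :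
    Γ.kernel G y x = Γ.kernel G x y := by
  classical
  have hvp : ∀ v, ∀ e : E, ∀ t ∈ Ioo 0 (Γ.len e),
      Γ.kernel G (Γ.vertex v) (Γ.pt e t) = Γ.kernel G (Γ.pt e t) (Γ.vertex v) := by
    intro v e t ht
    have ht' := Ioo_subset_Icc_self ht
    unfold kernel
    rw [tent_vertex, tent_pt_vertex ht', interp_vertex, interp_pt _ ht', pot_pt _ ht', pot_vertex,
      pot_vertex, hG v, hG v]
  rcases Γ.exists_rep x with ⟨v, rfl⟩ | ⟨e, s, hs, rfl⟩ <;>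
    rcases Γ.exists_rep y with ⟨w, rfl⟩ | ⟨e', t, ht, rfl⟩
  · exact congrArg₂ (· + ·) (hG v w) rfl
  · exact (hvp v e' t ht).symm
  · exact hvp w e s hs
  · have hs' := Ioo_subset_Icc_self hs
    have ht' := Ioo_subset_Icc_self ht
    unfold kernel
    rw [interp_pt _ hs', interp_pt _ ht', pot_pt _ hs', pot_pt _ hs', pot_pt _ ht', pot_pt _ ht',
      tent_pt_pt hs' ht', tent_pt_pt ht' hs', hG (Γ.src e'), hG (Γ.src e'), hG (Γ.tgt e'),
      hG (Γ.tgt e')]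
    by_cases h : e = e'
    · subst h; simp only [if_true]; rw [min_comm]; ring
    · simp only [h, Ne.symm h, if_false]; ring

/-- The function with values `u` at the vertices and second derivative `-2 b e` along `e`. -/
noncomputable def quad (Γ : LengthGraph V E) (u : V → ℝ) (b : E → ℝ) : Γ.Point → ℝ :=
  Γ.glueFun u (fun e s => (1 - s / Γ.len e) * u (Γ.src e) + s / Γ.len e * u (Γ.tgt e) +
      b e * (s * (Γ.len e - s)))
    (fun e => by simp) (fun e => by simp [div_self (Γ.len_pos e).ne'])

lemma quad_vertex (u : V → ℝ) (b : E → ℝ) (v : V) : Γ.quad u b (Γ.vertex v) = u v := rfl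

lemma quad_pt (u : V → ℝ) (b : E → ℝ) {e : E} {s : ℝ} (hs : s ∈ Icc 0 (Γ.len e)) :
    Γ.quad u b (Γ.pt e s) = (1 - s / Γ.len e) * u (Γ.src e) + s / Γ.len e * u (Γ.tgt e) +
      b e * (s * (Γ.len e - s)) := by
  unfold quad; rw [Γ.glueFun_pt _ _ _ _ hs]

lemma continuous_quad (u : V → ℝ) (b : E → ℝ) : Continuous (Γ.quad u b) :=
  Γ.continuous_glueFun _ _ _ _ fun e' => by fun_prop

/-- The coefficient of s (L - s) on the diagonal is (1 - r/L) / L, which is the density of the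
admissible measure before division by the genus (`IsGreen.edgeDensity_eq`). -/
lemma kernel_self {G : V → V → ℝ} (hG : ∀ v w, G v w = G w v) (x : Γ.Point) :
    Γ.kernel G x x = Γ.quad (fun v => G v v) (fun e => (1 - (G (Γ.src e) (Γ.src e) +
      G (Γ.tgt e) (Γ.tgt e) - 2 * G (Γ.src e) (Γ.tgt e)) / Γ.len e) / Γ.len e) x := by
  classical
  rcases Γ.exists_rep x with ⟨v, rfl⟩ | ⟨e, s, hs, rfl⟩
  · exact add_zero _
  · have hs' := Ioo_subset_Icc_self hs
    have hL := Γ.len_pos e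
    unfold kernel
    rw [interp_pt _ hs', pot_pt _ hs', pot_pt _ hs', tent_pt_pt hs' hs', quad_pt _ _ hs',
      hG (Γ.tgt e) (Γ.src e)]
    simp only [if_true, min_self]
    field_simp
    ring

lemma kernel_vertex (G : V → V → ℝ) (v : V) (y : Γ.Point) :
    Γ.kernel G y (Γ.vertex v) = Γ.quad (fun w => G v w) 0 y := by
  rcases Γ.exists_rep y with ⟨w, rfl⟩ | ⟨e, s, hs, rfl⟩
  · exact add_zero _
  · have hs' := Ioo_subset_Icc_self hs
    unfold kernel
    rw [interp_vertex, tent_pt_vertex hs', pot_pt _ hs', quad_pt _ _ hs']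
    simp

lemma integral_quad_edge (u : V → ℝ) (b : E → ℝ) (e : E) :
    ∫ t in (0)..(Γ.len e), Γ.quad u b (Γ.pt e t) =
      Γ.len e * ((u (Γ.src e) + u (Γ.tgt e)) / 2) + b e * Γ.len e ^ 3 / 6 := by
  have hL := Γ.len_pos e
  have h1 : ∀ t ∈ uIcc 0 (Γ.len e), Γ.quad u b (Γ.pt e t) = u (Γ.src e) +
      ((u (Γ.tgt e) - u (Γ.src e)) / Γ.len e + b e * Γ.len e) * t - b e * t ^ 2 := by
    intro t ht
    rw [uIcc_of_le hL.le] at ht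
    rw [quad_pt _ _ ht]
    field_simp; ring
  rw [intervalIntegral.integral_congr h1, intervalIntegral.integral_sub, intervalIntegral.integral_add,
    intervalIntegral.integral_const, intervalIntegral.integral_const_mul,
    intervalIntegral.integral_const_mul, integral_id, integral_pow]
  · simp only [smul_eq_mul]
    norm_num
    field_simp
    ring
  all_goals exact (Continuous.intervalIntegrable (by fun_prop) _ _)

lemma integral_tent_edge {e : E} {s : ℝ} (hs : s ∈ Icc 0 (Γ.len e)) :
    ∫ t in (0)..(Γ.len e), Γ.tent (Γ.pt e s) (Γ.pt e t) = s * (Γ.len e - s) / 2 := by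
  classical
  have hL := Γ.len_pos e
  have h1 : ∀ t ∈ uIcc 0 (Γ.len e), Γ.tent (Γ.pt e s) (Γ.pt e t) = min t s - s / Γ.len e * t := by
    intro t ht
    rw [uIcc_of_le hL.le] at ht
    rw [tent_pt_pt hs ht, if_pos rfl]
    ring
  have hc : Continuous fun t : ℝ => min t s := by fun_prop
  rw [intervalIntegral.integral_congr h1, intervalIntegral.integral_sub (hc.intervalIntegrable _ _)
    (Continuous.intervalIntegrable (by fun_prop) _ _), intervalIntegral.integral_const_mul, integral_id,
    ← intervalIntegral.integral_add_adjacent_intervals (hc.intervalIntegrable 0 s)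
      (hc.intervalIntegrable s _)]
  have h2 : ∫ t in (0)..s, min t s = ∫ t in (0)..s, t := by
    refine intervalIntegral.integral_congr fun t ht => ?_
    rw [uIcc_of_le hs.1] at ht
    exact min_eq_left ht.2
  have h3 : ∫ t in s..(Γ.len e), min t s = ∫ t in s..(Γ.len e), s := by
    refine intervalIntegral.integral_congr fun t ht => ?_
    rw [uIcc_of_le hs.2] at ht
    exact min_eq_right ht.1
  rw [h2, h3, integral_id, intervalIntegral.integral_const]
  simp only [smul_eq_mul]
  field_simp
  ring

lemma integral_tent_edge_of_ne {e e' : E} (h : e' ≠ e) {s : ℝ} (hs : s ∈ Icc 0 (Γ.len e)) :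
    ∫ t in (0)..(Γ.len e'), Γ.tent (Γ.pt e s) (Γ.pt e' t) = 0 := by
  classical
  have hL := Γ.len_pos e'
  have h1 : ∀ t ∈ uIcc 0 (Γ.len e'), Γ.tent (Γ.pt e s) (Γ.pt e' t) = 0 := by
    intro t ht
    rw [uIcc_of_le hL.le] at ht
    rw [tent_pt_pt hs ht, if_neg h]
  rw [intervalIntegral.integral_congr h1]
  simp

variable [Fintype V] [Fintype E] {G : V → V → ℝ}

lemma IsGreen.resistance_vertex (hG : Γ.IsGreen G) (hΓ : Γ.Conn) (v w : V) :
    Γ.resistance (Γ.vertex v) (Γ.vertex w) = G v v + G w w - 2 * G v w := by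
  rw [hG.resistance_eq hΓ]
  simp only [kernel_vertex, quad_vertex]
  rw [hG.symm w v]; ring

/-- The formula needs no separate clause for bridges: there r = L, so the right side vanishes;
otherwise it is the parallel law. -/
theorem IsGreen.edgeDensity_eq (hG : Γ.IsGreen G) (hΓ : Γ.Conn) (e : E) :
    Γ.edgeDensity e = (1 - (G (Γ.src e) (Γ.src e) + G (Γ.tgt e) (Γ.tgt e) -
      2 * G (Γ.src e) (Γ.tgt e)) / Γ.len e) / Γ.len e := by
  classical
  have hr := hG.isResistance
  unfold edgeDensity
  split_ifs with h
  · have hΓ' := conn_of_connectedSpace h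
    obtain ⟨G', hG'⟩ := hΓ'.exists_isGreen
    rw [hG'.resistance_vertex hΓ']
    exact (hr.delete_formula hΓ e hG'.isResistance).symm
  · have h2 : ¬ (Γ.delete e).Conn := fun h3 => by
      have : Nonempty V := ⟨Γ.src e⟩
      exact h (connectedSpace_of_conn h3)
    have h4 := hr.eq_len_of_delete_not_conn hΓ e h2
    rw [h4, div_self (Γ.len_pos e).ne']
    simp

end LengthGraph

/-! ### Integration against the admissible measure -/

namespace PMGraph
open LengthGraph

variable {V E : Type*} [Fintype V] [Fintype E] (Γ : PMGraph V E)

lemma integrable_of_continuous {f : Γ.Point → ℝ} (hf : Continuous f) (μ : Measure Γ.Point)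
    [IsFiniteMeasure μ] : Integrable f μ :=
  hf.integrable_of_hasCompactSupport (HasCompactSupport.of_compactSpace f)

lemma integrable_admissible {f : Γ.Point → ℝ} (hf : Continuous f) :
    Integrable f Γ.admissibleMeasure := by
  refine Integrable.smul_measure ((integrable_finsetSum_measure.2 fun v _ => ?_).add_measure
    (integrable_finsetSum_measure.2 fun e _ => ?_)) ENNReal.ofReal_ne_top
  · exact (Γ.integrable_of_continuous hf _).smul_measure (ENNReal.natCast_ne_top _)
  · exact (Γ.integrable_of_continuous hf _).smul_measure ENNReal.ofReal_ne_top

lemma integral_admissible {f : Γ.Point → ℝ} (hf : Continuous f) (hg : 0 < (Γ.genus : ℝ))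
    (hd : ∀ e, 0 ≤ Γ.edgeDensity e) : ∫ x, f x ∂Γ.admissibleMeasure =
      1 / (Γ.genus : ℝ) * (∑ v, (Γ.q v : ℝ) * f (Γ.vertex v) +
        ∑ e, Γ.edgeDensity e * ∫ t in (0)..(Γ.len e), f (Γ.pt e t)) := by
  have i1 : ∀ v ∈ (Finset.univ : Finset V),
      Integrable f ((Γ.q v : ENNReal) • Measure.dirac (Γ.vertex v)) := fun v _ =>
    (Γ.integrable_of_continuous hf _).smul_measure (ENNReal.natCast_ne_top _)
  have i2 : ∀ e ∈ (Finset.univ : Finset E), Integrable f (ENNReal.ofReal (Γ.edgeDensity e) •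
      Measure.map (Γ.pt e) (volume.restrict (Icc 0 (Γ.len e)))) := fun e _ =>
    (Γ.integrable_of_continuous hf _).smul_measure ENNReal.ofReal_ne_top
  unfold admissibleMeasure
  rw [integral_smul_measure, ENNReal.toReal_ofReal (by positivity), smul_eq_mul,
    integral_add_measure (integrable_finsetSum_measure.2 i1) (integrable_finsetSum_measure.2 i2),
    integral_finsetSum_measure i1, integral_finsetSum_measure i2]
  congr 2
  · refine Finset.sum_congr rfl fun v _ => ?_
    rw [integral_smul_measure, integral_dirac' _ _ hf.stronglyMeasurable]
    simp
  · refine Finset.sum_congr rfl fun e _ => ?_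
    rw [integral_smul_measure, ENNReal.toReal_ofReal (hd e), smul_eq_mul,
      integral_map (Γ.continuous_pt e).measurable.aemeasurable hf.aestronglyMeasurable,
      integral_Icc_eq_integral_Ioc, intervalIntegral.integral_of_le (Γ.len_pos e).le]

end PMGraph

namespace PMGraph
open LengthGraph

variable {V E : Type*} [Fintype V] [Fintype E] (Γ : PMGraph V E)

open Classical in
/-- The weights at the vertices of the admissible measure, after the mass of each edge has been moved
to its end points. -/
noncomputable def weight (v : V) : ℝ :=
  1 / (Γ.genus : ℝ) * (Γ.q v + ∑ e, Γ.edgeDensity e * Γ.len e / 2 *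
    ((if Γ.src e = v then 1 else 0) + (if Γ.tgt e = v then 1 else 0)))

variable {Γ}

lemma sum_weight_mul (f : V → ℝ) : ∑ v, Γ.weight v * f v =
    1 / (Γ.genus : ℝ) * (∑ v, (Γ.q v : ℝ) * f v +
      ∑ e, Γ.edgeDensity e * Γ.len e / 2 * (f (Γ.src e) + f (Γ.tgt e))) := by
  classical
  unfold weight
  simp_rw [mul_assoc, ← Finset.mul_sum, add_mul, Finset.sum_add_distrib, Finset.sum_mul]
  congr 2
  rw [Finset.sum_comm]
  refine Finset.sum_congr rfl fun e _ => ?_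
  simp [mul_assoc, ← Finset.mul_sum, add_mul, Finset.sum_add_distrib]

/-- An affine function integrates by its end values, whence `weight`; the bulge contributes ∫ s (L -
s) ds = L³/6. -/
lemma integral_quad (hg : 0 < (Γ.genus : ℝ)) (hd : ∀ e, 0 ≤ Γ.edgeDensity e) (u : V → ℝ)
    (b : E → ℝ) : ∫ x, Γ.quad u b x ∂Γ.admissibleMeasure = ∑ v, Γ.weight v * u v +
      1 / (6 * (Γ.genus : ℝ)) * ∑ e, Γ.edgeDensity e * b e * Γ.len e ^ 3 := by
  rw [Γ.integral_admissible (continuous_quad u b) hg hd, sum_weight_mul]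
  simp only [quad_vertex, integral_quad_edge]
  have : ∑ e, Γ.edgeDensity e * (Γ.len e * ((u (Γ.src e) + u (Γ.tgt e)) / 2) +
      b e * Γ.len e ^ 3 / 6) = ∑ e, Γ.edgeDensity e * Γ.len e / 2 * (u (Γ.src e) + u (Γ.tgt e)) +
      1 / 6 * ∑ e, Γ.edgeDensity e * b e * Γ.len e ^ 3 := by
    rw [Finset.mul_sum, ← Finset.sum_add_distrib]
    exact Finset.sum_congr rfl fun e _ => by ring
  rw [this]
  field_simp
  ring

variable {G : V → V → ℝ}

/-- The tent integrates to s (L - s)/2 over its own edge, so the result is again quadratic along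
edges and can be integrated a second time. -/
lemma integral_kernel (hg : 0 < (Γ.genus : ℝ)) (hd : ∀ e, 0 ≤ Γ.edgeDensity e)
    (hG : ∀ v w, G v w = G w v) (y : Γ.Point) :
    ∫ x, Γ.kernel G y x ∂Γ.admissibleMeasure =
      Γ.quad (fun w => ∑ v, Γ.weight v * G v w)
        (fun e => Γ.edgeDensity e / (2 * (Γ.genus : ℝ))) y := by
  classical
  rcases Γ.exists_rep y with ⟨w, rfl⟩ | ⟨e, s, hs, rfl⟩
  · simp_rw [kernel_comm hG _ (Γ.vertex w), kernel_vertex, integral_quad hg hd, quad_vertex, hG w]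
    simp
  · have hs' := Ioo_subset_Icc_self hs
    have h1 : ∀ x, Γ.interp (Γ.pot G (Γ.pt e s)) x = Γ.quad (Γ.pot G (Γ.pt e s)) 0 x := fun x => by
      rcases Γ.exists_rep x with ⟨w, rfl⟩ | ⟨e', t, ht, rfl⟩
      · rfl
      · rw [interp_pt _ (Ioo_subset_Icc_self ht), quad_pt _ _ (Ioo_subset_Icc_self ht)]; simp
    unfold kernel
    rw [integral_add (Γ.integrable_admissible (continuous_interp _))
      (Γ.integrable_admissible (continuous_tent _))]
    simp_rw [h1]
    have h3 : ∑ e', Γ.edgeDensity e' * ∫ t in (0)..(Γ.len e'), Γ.tent (Γ.pt e s) (Γ.pt e' t) =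
        Γ.edgeDensity e * (s * (Γ.len e - s) / 2) := by
      rw [Finset.sum_eq_single e (fun e' _ he => by
        rw [integral_tent_edge_of_ne he hs', mul_zero]) (by simp), integral_tent_edge hs']
    rw [integral_quad hg hd, Γ.integral_admissible (continuous_tent _) hg hd, quad_pt _ _ hs', h3]
    simp only [tent_pt_vertex hs', pot_pt _ hs']
    have h2 : ∑ v, Γ.weight v * ((1 - s / Γ.len e) * G v (Γ.src e) + s / Γ.len e * G v (Γ.tgt e)) =
        (1 - s / Γ.len e) * ∑ v, Γ.weight v * G v (Γ.src e) +
        s / Γ.len e * ∑ v, Γ.weight v * G v (Γ.tgt e) := by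
      rw [Finset.mul_sum, Finset.mul_sum, ← Finset.sum_add_distrib]
      exact Finset.sum_congr rfl fun v _ => by ring
    rw [h2]
    simp only [mul_zero, Finset.sum_const_zero, Pi.zero_apply, zero_mul, zero_add, add_zero]
    field_simp

lemma edgeDensity_nonneg (hG : Γ.IsGreen G) (hΓ : Γ.Conn) (e : E) : 0 ≤ Γ.edgeDensity e := by
  rw [hG.edgeDensity_eq hΓ]
  have hL := Γ.len_pos e
  have h := hG.isResistance.le_len e
  refine div_nonneg (sub_nonneg.2 ?_) hL.le
  rw [div_le_one hL]
  exact h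

lemma resistance_eq_quad (hG : Γ.IsGreen G) (hΓ : Γ.Conn) (x y : Γ.Point) :
    Γ.resistance x y = Γ.quad (fun v => G v v) Γ.edgeDensity x +
      Γ.quad (fun v => G v v) Γ.edgeDensity y - 2 * Γ.kernel G y x := by
  rw [hG.resistance_eq hΓ, kernel_comm hG.symm y x, kernel_self hG.symm, kernel_self hG.symm]
  simp_rw [← hG.edgeDensity_eq hΓ]
  ring

lemma integral_const_admissible (hg : 0 < (Γ.genus : ℝ)) (hd : ∀ e, 0 ≤ Γ.edgeDensity e)
    (hm : ∑ v, Γ.weight v = 1) (c : ℝ) : ∫ _, c ∂Γ.admissibleMeasure = c := by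
  have h1 : ∀ x, Γ.quad (fun _ => c) 0 x = c := fun x => by
    rcases Γ.exists_rep x with ⟨w, rfl⟩ | ⟨e', t, ht, rfl⟩
    · rfl
    · rw [quad_pt _ _ (Ioo_subset_Icc_self ht)]; simp; ring
  have h2 := integral_quad hg hd (fun _ => c) 0
  simp_rw [h1, ← Finset.sum_mul, hm] at h2
  rw [h2]; simp

section
variable (hg : 0 < (Γ.genus : ℝ)) (hG : Γ.IsGreen G) (hΓ : Γ.Conn) (hm : ∑ v, Γ.weight v = 1)
include hg hG hΓ hm

lemma integral_resistance (y : Γ.Point) : ∫ x, Γ.resistance x y ∂Γ.admissibleMeasure =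
    (∑ v, Γ.weight v * G v v + 1 / (6 * (Γ.genus : ℝ)) * ∑ e, Γ.edgeDensity e ^ 2 * Γ.len e ^ 3) +
      Γ.quad (fun v => G v v) Γ.edgeDensity y -
      2 * Γ.quad (fun w => ∑ v, Γ.weight v * G v w)
        (fun e => Γ.edgeDensity e / (2 * (Γ.genus : ℝ))) y := by
  have hd := edgeDensity_nonneg hG hΓ
  simp_rw [resistance_eq_quad hG hΓ]
  have i1 := Γ.integrable_admissible (continuous_quad (fun v => G v v) Γ.edgeDensity)
  have i2 := Γ.integrable_admissible
    (continuous_const (y := Γ.quad (fun v => G v v) Γ.edgeDensity y))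
  have i3 := (Γ.integrable_admissible (continuous_kernel G y)).const_mul 2
  have i12 : Integrable (fun x => Γ.quad (fun v => G v v) Γ.edgeDensity x +
      Γ.quad (fun v => G v v) Γ.edgeDensity y) Γ.admissibleMeasure := i1.add i2
  rw [integral_sub i12 i3, integral_add i1 i2, integral_const_admissible hg hd hm, integral_quad hg hd,
    integral_const_mul, integral_kernel hg hd hG.symm]
  simp_rw [sq]

lemma aInv_eq : Γ.aInv = ∑ v, Γ.weight v * G v v - ∑ w, Γ.weight w * ∑ v, Γ.weight v * G v w +
    (1 / (6 * (Γ.genus : ℝ)) - 1 / (12 * (Γ.genus : ℝ) ^ 2)) *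
      ∑ e, Γ.edgeDensity e ^ 2 * Γ.len e ^ 3 := by
  have hd := edgeDensity_nonneg hG hΓ
  unfold aInv
  simp_rw [integral_resistance hg hG hΓ hm]
  have i1 := Γ.integrable_admissible (continuous_quad (fun v => G v v) Γ.edgeDensity)
  have i2 := (Γ.integrable_admissible (continuous_quad (fun w => ∑ v, Γ.weight v * G v w)
        (fun e => Γ.edgeDensity e / (2 * (Γ.genus : ℝ))))).const_mul 2
  set c := ∑ v, Γ.weight v * G v v + 1 / (6 * (Γ.genus : ℝ)) *
    ∑ e, Γ.edgeDensity e ^ 2 * Γ.len e ^ 3 with hc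
  have i0 := Γ.integrable_admissible (continuous_const (y := c))
  have i01 : Integrable (fun x => c + Γ.quad (fun v => G v v) Γ.edgeDensity x)
      Γ.admissibleMeasure := i0.add i1
  rw [integral_sub i01 i2, integral_add i0 i1, integral_const_admissible hg hd hm, integral_const_mul,
    integral_quad hg hd, integral_quad hg hd]
  have h3 : ∑ e, Γ.edgeDensity e * (Γ.edgeDensity e / (2 * (Γ.genus : ℝ))) * Γ.len e ^ 3 =
      1 / (2 * (Γ.genus : ℝ)) * ∑ e, Γ.edgeDensity e ^ 2 * Γ.len e ^ 3 := by
    rw [Finset.mul_sum]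
    exact Finset.sum_congr rfl fun e _ => by ring
  have h4 : ∑ e, Γ.edgeDensity e * Γ.edgeDensity e * Γ.len e ^ 3 =
    ∑ e, Γ.edgeDensity e ^ 2 * Γ.len e ^ 3 := Finset.sum_congr rfl fun e _ => by ring
  rw [h3, h4, hc]
  field_simp
  ring

lemma epsilonInv_eq : Γ.epsilonInv = ∑ v, (Γ.canonicalDivisor v : ℝ) *
    (∑ w, Γ.weight w * G w w + 1 / (6 * (Γ.genus : ℝ)) * ∑ e, Γ.edgeDensity e ^ 2 * Γ.len e ^ 3 +
      G v v - 2 * ∑ w, Γ.weight w * G w v) := by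
  unfold epsilonInv
  refine Finset.sum_congr rfl fun v _ => ?_
  congr 1
  have h1 : ∀ y, Γ.resistance (Γ.vertex v) y = Γ.resistance y (Γ.vertex v) := fun y => by
    rw [resistance_eq_quad hG hΓ, resistance_eq_quad hG hΓ, kernel_comm hG.symm]; ring
  simp_rw [h1]
  rw [integral_resistance hg hG hΓ hm, quad_vertex, quad_vertex]

end

omit [Fintype V] in
lemma canonicalDivisor_eq (v : V) : Γ.canonicalDivisor v = (Γ.deg v : ℤ) - 2 + 2 * (Γ.q v : ℤ) := by
  unfold canonicalDivisor; rw [valence_vertex]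

/-- The expression of `φ` by the resistances between vertices. -/
theorem phi_eq (hgenus : Γ.genus = 3) (hG : Γ.IsGreen G) (hΓ : Γ.Conn) {r : V → V → ℝ}
    (hr : r = fun v w => G v v + G w w - 2 * G v w) {K : V → ℕ}
    (hK : ∀ v, Γ.deg v + 2 * Γ.q v = K v + 2) (hsum : ∑ v, K v = 4) (y : V) :
    Γ.phi = (∑ v, ∑ w, (K v : ℝ) * K w * r v w) / 12 -
      13 / 12 * (∑ e, r (Γ.src e) (Γ.tgt e) / Γ.len e * (r (Γ.src e) y + r (Γ.tgt e) y) -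
        2 * ∑ v, r v y) +
      13 / 36 * ∑ e, Γ.len e * (1 - r (Γ.src e) (Γ.tgt e) / Γ.len e) ^ 2 -
      1 / 4 * ∑ e, Γ.len e := by
  have hres : Γ.IsResistance r := hr ▸ hG.isResistance
  have hg : (Γ.genus : ℝ) = 3 := by rw [hgenus]; norm_num
  have hg0 : 0 < (Γ.genus : ℝ) := by rw [hg]; norm_num
  have hF : ∀ e, Γ.edgeDensity e * Γ.len e = 1 - r (Γ.src e) (Γ.tgt e) / Γ.len e := fun e => by
    have hL := Γ.len_pos e
    rw [hG.edgeDensity_eq hΓ, hr]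
    field_simp
  have hKf : ∀ f : V → ℝ, ∑ v, (K v : ℝ) * f v = ∑ e, (f (Γ.src e) + f (Γ.tgt e)) - 2 * ∑ v, f v +
      2 * ∑ v, (Γ.q v : ℝ) * f v := fun f => by
    rw [← sum_deg_mul, Finset.mul_sum, Finset.mul_sum, ← Finset.sum_sub_distrib,
      ← Finset.sum_add_distrib]
    refine Finset.sum_congr rfl fun v _ => ?_
    have : (Γ.deg v : ℝ) + 2 * Γ.q v = K v + 2 := by exact_mod_cast hK v
    have h2 : (K v : ℝ) = Γ.deg v + 2 * Γ.q v - 2 := by linarith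
    rw [h2]; ring
  -- As functionals, K - 6 `weight` = N, where 6 is twice the genus; the r-potentials of K and 6
  -- `weight` thus differ by the constant κ.
  have hN : ∀ f : V → ℝ, ∑ v, (K v : ℝ) * f v - 6 * ∑ v, Γ.weight v * f v =
      ∑ e, r (Γ.src e) (Γ.tgt e) / Γ.len e * (f (Γ.src e) + f (Γ.tgt e)) - 2 * ∑ v, f v := fun f => by
    rw [hKf, sum_weight_mul, hg]
    have : ∑ e, Γ.edgeDensity e * Γ.len e / 2 * (f (Γ.src e) + f (Γ.tgt e)) =
        (∑ e, (f (Γ.src e) + f (Γ.tgt e)) -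
          ∑ e, r (Γ.src e) (Γ.tgt e) / Γ.len e * (f (Γ.src e) + f (Γ.tgt e))) / 2 := by
      rw [← Finset.sum_sub_distrib, Finset.sum_div]
      refine Finset.sum_congr rfl fun e _ => ?_
      rw [hF]; ring
    rw [this]; ring
  have hK1 : ∑ v, (K v : ℝ) = 4 := by exact_mod_cast hsum
  have hm : ∑ v, Γ.weight v = 1 := by
    have : Nonempty V := ⟨y⟩
    have h1 := hN (fun _ => 1)
    have h2 := hres.sum_kappa
    simp only [mul_one, hK1, Finset.sum_const, Finset.card_univ, nsmul_eq_mul] at h1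
    norm_num at h1 h2
    linarith
  set κ := ∑ e, r (Γ.src e) (Γ.tgt e) / Γ.len e * (r (Γ.src e) y + r (Γ.tgt e) y) -
        2 * ∑ v, r v y with hκ
  have hNr : ∀ w, ∑ v, (K v : ℝ) * r v w - 6 * ∑ v, Γ.weight v * r v w = κ := fun w => by
    rw [hN, hκ]; exact hres.kappa_eq w y
  set m := Γ.weight with hmdef
  set θ := ∑ v, ∑ w, (K v : ℝ) * K w * r v w with hθ
  have hpair : ∀ A B : V → ℝ, ∑ w, B w * ∑ v, A v * r v w =
      (∑ v, A v * G v v) * ∑ w, B w + (∑ v, A v) * (∑ w, B w * G w w) -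
        2 * ∑ w, B w * ∑ v, A v * G v w := by
    intro A B
    have h1 : ∀ w, ∑ v, A v * r v w =
        ∑ v, A v * G v v + (∑ v, A v) * G w w - 2 * ∑ v, A v * G v w := fun w => by
      rw [Finset.sum_mul, Finset.mul_sum, ← Finset.sum_add_distrib, ← Finset.sum_sub_distrib]
      exact Finset.sum_congr rfl fun v _ => by rw [hr]; ring
    rw [Finset.mul_sum, Finset.mul_sum, Finset.mul_sum, ← Finset.sum_add_distrib,
      ← Finset.sum_sub_distrib]
    exact Finset.sum_congr rfl fun w _ => by rw [h1]; ring
  have hcomm : ∀ A B : V → ℝ, ∑ w, B w * ∑ v, A v * r v w = ∑ w, A w * ∑ v, B v * r v w := by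
    intro A B
    simp_rw [Finset.mul_sum]
    rw [Finset.sum_comm]
    exact Finset.sum_congr rfl fun v _ => Finset.sum_congr rfl fun w _ => by
      rw [hres.symm v w]; ring
  have hθ' : θ = ∑ w, (K w : ℝ) * ∑ v, (K v : ℝ) * r v w := by
    rw [hθ, Finset.sum_comm]
    refine Finset.sum_congr rfl fun w _ => ?_
    rw [Finset.mul_sum]
    exact Finset.sum_congr rfl fun v _ => by ring
  -- Pairing K r - 6 m r = κ with m (mass 1) and with K (mass 4) expresses both K r m and m r m
  -- through θ and κ.
  have e1 : ∑ w, m w * ∑ v, (K v : ℝ) * r v w - 6 * ∑ w, m w * ∑ v, m v * r v w = κ := by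
    have : ∑ w, m w * (∑ v, (K v : ℝ) * r v w - 6 * ∑ v, m v * r v w) = ∑ w, m w * κ :=
      Finset.sum_congr rfl fun w _ => by rw [hNr]
    rw [← Finset.sum_mul, hm, one_mul] at this
    rw [← this, Finset.mul_sum, ← Finset.sum_sub_distrib]
    exact Finset.sum_congr rfl fun w _ => by ring
  have e2 : θ - 6 * ∑ w, (K w : ℝ) * ∑ v, m v * r v w = 4 * κ := by
    have : ∑ w, (K w : ℝ) * (∑ v, (K v : ℝ) * r v w - 6 * ∑ v, m v * r v w) =
      ∑ w, (K w : ℝ) * κ := Finset.sum_congr rfl fun w _ => by rw [hNr]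
    rw [← Finset.sum_mul, hK1] at this
    rw [← this, hθ', Finset.mul_sum, ← Finset.sum_sub_distrib]
    exact Finset.sum_congr rfl fun w _ => by ring
  have e3 := hpair m m
  have e4 := hpair m (fun v => (K v : ℝ))
  have e5 := hcomm m (fun v => (K v : ℝ))
  rw [hm] at e3 e4
  rw [hK1] at e4
  have hQ : ∑ e, Γ.edgeDensity e ^ 2 * Γ.len e ^ 3 =
      ∑ e, Γ.len e * (1 - r (Γ.src e) (Γ.tgt e) / Γ.len e) ^ 2 :=
    Finset.sum_congr rfl fun e _ => by rw [← hF]; ring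
  have hKK : ∀ v, (Γ.canonicalDivisor v : ℝ) = K v := fun v => by
    have h1 : Γ.canonicalDivisor v = (K v : ℤ) := by
      rw [canonicalDivisor_eq]; have := hK v; omega
    rw [h1]; norm_num
  have ha := aInv_eq hg0 hG hΓ hm
  have hε := epsilonInv_eq hg0 hG hΓ hm
  rw [hQ, hg] at ha hε
  simp_rw [hKK, mul_sub, mul_add, Finset.sum_sub_distrib, Finset.sum_add_distrib, ← Finset.sum_mul,
    hK1] at hε
  have e6 : ∑ v, (K v : ℝ) * (2 * ∑ w, Γ.weight w * G w v) =
      2 * ∑ v, (K v : ℝ) * ∑ w, m w * G w v := by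
    rw [Finset.mul_sum]; exact Finset.sum_congr rfl fun v _ => by ring
  rw [e6] at hε
  unfold phi totalLength
  rw [ha, hε, hg]
  linarith

end PMGraph

/-! ### Conclusion -/

theorem mainTheorem9 {V E : Type*} [Fintype V] [Fintype E] (Γ : PMGraph V E)
    (hirr : Γ.Irreducible) (hgenus : Γ.genus = 3) :
    (892 - 11 * Real.sqrt 79) / 14580 * Γ.totalLength ≤ Γ.phi := by
  have hΓ : Γ.Conn := LengthGraph.conn_of_connectedSpace Γ.connected
  obtain ⟨G, hG⟩ := hΓ.exists_isGreen
  obtain ⟨y⟩ : Nonempty V := by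
    obtain ⟨p⟩ := Γ.connected.toNonempty
    rcases Γ.exists_rep p with ⟨v, -⟩ | ⟨e, -⟩
    · exact ⟨v⟩
    · exact ⟨Γ.src e⟩
  have hK : ∀ v, Γ.deg v + 2 * Γ.q v = (Γ.canonicalDivisor v).toNat + 2 := fun v => by
    have h1 := Γ.effective v
    have h2 := PMGraph.canonicalDivisor_eq (Γ := Γ) v
    have h3 := LengthGraph.valence_vertex (Γ := Γ.toLengthGraph) v
    rw [h3] at h1
    omega
  -- The degree 2g - 2 of the canonical divisor, by the handshake identity; truncation to ℕ loses
  -- nothing because the divisor is effective.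
  have hsum : ∑ v, (Γ.canonicalDivisor v).toNat = 4 := by
    have h1 : ∑ v, (Γ.deg v + 2 * Γ.q v) = ∑ v, ((Γ.canonicalDivisor v).toNat + 2) :=
      Finset.sum_congr rfl fun v _ => hK v
    simp only [Finset.sum_add_distrib, ← Finset.mul_sum, Finset.sum_const, Finset.card_univ,
      smul_eq_mul] at h1
    have h2 : ∑ v, Γ.deg v = 2 * Fintype.card E := by
      have := LengthGraph.sum_deg_mul (Γ := Γ.toLengthGraph) (fun _ => 1)
      simp only [mul_one, Finset.sum_const, Finset.card_univ, nsmul_eq_mul] at this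
      have h3 : ((∑ v, Γ.deg v : ℕ) : ℝ) = ((2 * Fintype.card E : ℕ) : ℝ) := by
        push_cast; rw [this]; ring
      exact_mod_cast h3
    unfold PMGraph.genus at hgenus
    have h4 : (∑ v, (Γ.q v : ℤ)) = ((∑ v, Γ.q v : ℕ) : ℤ) := by push_cast; rfl
    rw [h4] at hgenus
    omega
  have h := LengthGraph.network_bound hΓ hG.isResistance hK hsum y
  rw [PMGraph.phi_eq hgenus hG hΓ rfl hK hsum y]
  have hl : 0 ≤ ∑ e, Γ.len e := Finset.sum_nonneg fun e _ => (Γ.len_pos e).le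
  -- Since 8.5² = 72.25, this crude bound already places the required constant below 183/3328.
  have hs : (8.5 : ℝ) ≤ Real.sqrt 79 := Real.le_sqrt_of_sq_le (by norm_num)
  have hc : (892 - 11 * Real.sqrt 79) / 14580 ≤ 183 / 3328 := by linarith
  have := mul_le_mul_of_nonneg_right hc hl
  unfold LengthGraph.totalLength
  linarith
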